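/- Let $X$ be a compact metric space that is geometrically doubling (every ball contains at most $A$ pairwise disjoint balls of half its radius), and let $\mu$ be a finite Borel measure on $X$ that is doubling: $0<\mu(B(x,r))$ and $\mu(B(x,2r))\le D\,\mu(B(x,r))$ for all $x\in X$, $r>0$. Let $\mathscr D$ be a finite Christ-type dyadic lattice on $X$ with parameters $0<\delta<1$, $c>0$, $C_1$, $M$: finite families $\mathcal E_0,\dots,\mathcal E_N$ of pairwise disjoint measurable sets (cubes), each family covering $X$ up to a $\mu$-null set, such that every $Q\in\mathcal E_k$ has diameter at most $C_1\delta^k$ and contains a ball of radius $c\,\delta^k$, every element of $\mathcal E_{k+1}$ is contained in an element of $\mathcal E_k$, and every $Q\in\mathcal E_k$ ($k<N$) contains at most $M$ elements of $\mathcal E_{k+1}$, called its sons. A cube is regarded together with its generation: $g(Q)=k$ for $Q\in\mathcal E_k$. For each cube $Q$ with $g(Q)<N$ let $(h_Q^j)_j$ be a finite family of real Haar functions: they are supported on $Q$, constant on each son of $Q$, orthogonal to constants in $L^2(\mu)$, orthonormal in $L^2(\mu)$, and satisfy $\|h_Q^j\|_{L^\infty(\mu)}\le K\mu(Q)^{-1/2}$.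 For integers $m,n\ge 0$, a generalized dyadic shift of complexity $(m,n)$ is an operator $$ Ш_{m,n}f(x)=\sum_{L\in\mathscr D}\int_L a_L(x,y)f(y)\,d\mu(y),\qquad a_L(x,y)=\sum_{\substack{I,J\subset L\\ g(I)=g(L)+m,\ g(J)=g(L)+n}}\ \sum_{i,j}c_{L,I,J}^{i,j}\,h_J^j(x)\,h_I^i(y), $$ where $L$ runs over the cubes with $g(L)+m<N$ and $g(L)+n<N$, and the real or complex coefficients satisfy $|c_{L,I,J}^{i,j}|\le\sqrt{\mu(I)}\sqrt{\mu(J)}/\mu(L)$. For a weight $w$ (measurable, $w>0$ $\mu$-a.e.) put $$[w]_{A_2}=\sup_{I\in\mathscr D}\Big(\frac1{\mu(I)}\int_I w\,d\mu\Big)\Big(\frac1{\mu(I)}\int_I w^{-1}\,d\mu\Big).$$ **Theorem.** There is a constant $C$, depending only on $A,D,\delta,c,C_1,M,K$, such that for all $X,\mu,\mathscr D$, Haar functions, $m,n\ge0$, shifts $Ш_{m,n}$ and weights $w$ as above with $[w]_{A_2}<\infty$, the integrals defining $Ш_{m,n}f$ converge absolutely for every $f\in L^2(w\,d\mu)$,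 and $$\|Ш_{m,n}: L^2(w\,d\mu)\to L^2(w\,d\mu)\|\le C\,(m+n+1)^3\,[w]_{A_2}.$$ -/

import Mathlib

open MeasureTheory Metric Finset
open scoped ENNReal NNReal

noncomputable section

/-- Every ball contains at most `A` pairwise disjoint balls of half its radius. -/
def GeometricallyDoubling (X : Type*) [MetricSpace X] (A : ℕ) : Prop :=
  ∀ (x : X) (r : ℝ), 0 < r → ∀ S : Finset X,
    (∀ y ∈ S, ball y (r / 2) ⊆ ball x r) →
    (S : Set X).PairwiseDisjoint (fun y => ball y (r / 2)) → S.card ≤ A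

/-- `μ` is doubling with constant `D`; all balls have positive measure. -/
def IsDoublingWith {X : Type*} [MetricSpace X] [MeasurableSpace X]
    (μ : Measure X) (D : ℝ≥0) : Prop :=
  ∀ (x : X) (r : ℝ), 0 < r →
    0 < μ (ball x r) ∧ μ (ball x (2 * r)) ≤ D * μ (ball x r)

/-- A finite dyadic lattice of Christ type, with generations `E 0, …, E N` (the values `E k` for
`N < k` are irrelevant). The `k`-th generation is a finite partition of `X` (up to a `μ`-null set,
as in Christ's construction) into measurable pieces of size comparable to `δ ^ k`: each has diameter
at most `C₁ * δ ^ k` and contains a ball of radius `c * δ ^ k`. Each piece of generation `k + 1`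
lies in a piece of generation `k`, and a piece has at most `M` sons. A cube of the lattice is a pair
(generation, piece): the same set may occur in several generations. -/
structure DyadicLattice {X : Type*} [MetricSpace X] [MeasurableSpace X]
    (μ : Measure X) (δ c C₁ : ℝ) (M : ℕ) where
  /-- the finest generation -/
  N : ℕ
  /-- the pieces of the `k`-th generation -/
  E : ℕ → Finset (Set X)
  measurable : ∀ k ≤ N, ∀ Q ∈ E k, MeasurableSet Q
  disjoint : ∀ k ≤ N, (E k : Set (Set X)).PairwiseDisjoint id
  cover : ∀ k ≤ N, ∀ᵐ x ∂μ, ∃ Q ∈ E k, x ∈ Q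
  nested : ∀ k < N, ∀ R ∈ E (k + 1), ∃ Q ∈ E k, R ⊆ Q
  diam_le : ∀ k ≤ N, ∀ Q ∈ E k, diam Q ≤ C₁ * δ ^ k
  ball_subset : ∀ k ≤ N, ∀ Q ∈ E k, ∃ z, ball z (c * δ ^ k) ⊆ Q
  card_sons_le : ∀ k < N, ∀ Q ∈ E k, {R : Set X | R ∈ E (k + 1) ∧ R ⊆ Q}.ncard ≤ M

section Lattice

variable {X : Type*} [MetricSpace X] [MeasurableSpace X] {μ : Measure X} {δ c C₁ : ℝ} {M : ℕ}

open Classical in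
/-- The cubes of generation `k + m` contained in the cube `L` of generation `k`. -/
def DyadicLattice.descendants (G : DyadicLattice μ δ c C₁ M) (k : ℕ) (L : Set X) (m : ℕ) :
    Finset (Set X) :=
  (G.E (k + m)).filter (fun I => I ⊆ L)

/-- The characteristic `[w]_{A₂} = sup_I ⟨w⟩_I ⟨w⁻¹⟩_I`, over all cubes `I` of the lattice. -/
def DyadicLattice.a2Char (G : DyadicLattice μ δ c C₁ M) (w : X → ℝ) : ℝ≥0∞ :=
  ⨆ k ∈ Set.Iic G.N, ⨆ I ∈ G.E k,
    (⨍⁻ x in I, ENNReal.ofReal (w x) ∂μ) * (⨍⁻ x in I, ENNReal.ofReal (w x)⁻¹ ∂μ)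

/-- A system of `L²(μ)`-normalized Haar functions: for each cube `Q` of generation `k < N`, functions
`h k Q j`, `j < num k Q`, supported on `Q`, constant on the sons of `Q`, orthogonal to constants,
orthonormal, and bounded by `K / μ(Q)^{1/2}`. The system need not be complete. -/
structure HaarSystem (G : DyadicLattice μ δ c C₁ M) (K : ℝ) where
  num : ℕ → Set X → ℕ
  h : ℕ → Set X → ℕ → X → ℝ
  support : ∀ k < G.N, ∀ Q ∈ G.E k, ∀ j < num k Q, ∀ x ∉ Q, h k Q j x = 0
  const_on_sons : ∀ k < G.N, ∀ Q ∈ G.E k, ∀ j < num k Q,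
    ∀ R ∈ G.descendants k Q 1, ∀ x ∈ R, ∀ y ∈ R, h k Q j x = h k Q j y
  integral_eq_zero : ∀ k < G.N, ∀ Q ∈ G.E k, ∀ j < num k Q, ∫ x, h k Q j x ∂μ = 0
  orthonormal : ∀ k < G.N, ∀ Q ∈ G.E k, ∀ i < num k Q, ∀ j < num k Q,
    ∫ x, h k Q i x * h k Q j x ∂μ = if i = j then 1 else 0
  bound : ∀ k < G.N, ∀ Q ∈ G.E k, ∀ j < num k Q,
    ∀ᵐ x ∂μ, |h k Q j x| ≤ K / √(μ.real Q)

/-- The coefficients of a generalized dyadic shift of complexity `(m, n)`: for each cube `L` of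
generation `k`, all cubes `I, J ⊆ L` of generations `k + m`, `k + n`, and all Haar functions `i` of
`I` and `j` of `J`, a scalar of modulus at most `√μ(I) √μ(J) / μ(L)`. The cubes `I` and `J` must
carry Haar functions, so `k + m < N` and `k + n < N`. -/
structure DyadicShift (𝕜 : Type*) [RCLike 𝕜] {G : DyadicLattice μ δ c C₁ M} {K : ℝ}
    (H : HaarSystem G K) (m n : ℕ) where
  coeff : ℕ → Set X → Set X → Set X → ℕ → ℕ → 𝕜
  bound : ∀ k, k + m < G.N → k + n < G.N → ∀ L ∈ G.E k,
    ∀ I ∈ G.descendants k L m, ∀ J ∈ G.descendants k L n,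
    ∀ i < H.num (k + m) I, ∀ j < H.num (k + n) J,
      ‖coeff k L I J i j‖ ≤ √(μ.real I) * √(μ.real J) / μ.real L

variable {𝕜 : Type*} [RCLike 𝕜] {G : DyadicLattice μ δ c C₁ M} {K : ℝ} {H : HaarSystem G K}
  {m n : ℕ}

/-- The kernel `a_L(x, y) = ∑ c_{L,I,J}^{i,j} h_J^j(x) h_I^i(y)` of the cube `L` of generation
`k`. -/
def DyadicShift.kernel (S : DyadicShift 𝕜 H m n) (k : ℕ) (L : Set X) (x y : X) : 𝕜 :=
  ∑ I ∈ G.descendants k L m, ∑ J ∈ G.descendants k L n,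
    ∑ i ∈ range (H.num (k + m) I), ∑ j ∈ range (H.num (k + n) J),
      S.coeff k L I J i j * ((H.h (k + n) J j x * H.h (k + m) I i y : ℝ) : 𝕜)

/-- The shift `f ↦ ∑_L ∫_L a_L(·, y) f(y) dμ(y)`. -/
def DyadicShift.toFun (S : DyadicShift 𝕜 H m n) (f : X → 𝕜) (x : X) : 𝕜 :=
  ∑ k ∈ (range G.N).filter (fun k => k + m < G.N ∧ k + n < G.N),
    ∑ L ∈ G.E k, ∫ y in L, S.kernel k L x y * f y ∂μ

end Lattice

/-- The measure `w dμ`. -/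
def weighted {X : Type*} [MeasurableSpace X] (μ : Measure X) (w : X → ℝ) : Measure X :=
  μ.withDensity (fun x => ENNReal.ofReal (w x))

end

/-!
The shift is compared with a martingale problem on the finite tree whose points are the cubes of the
finest generation ("leaves"). All Haar functions are constant on the leaves, so the shift only sees
the integrals of `f` over them, and its `k`-th kernel has three properties
(`DyadicShift.isShiftKernel_treeKernel`): it is bounded by `M² K² / μ(L)` on each cube `L` of
generation `k`; in each variable it is constant on the cubes `m + 1`, respectively `n + 1`,
generations further down; and it has mean zero on the cubes `m`, respectively `n`, generations
further down. So in the bilinear form of the kernel `f` and `g` may be replaced by the martingale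
differences of generation `k + m` and `k + n`, whose squares are summable over `k`. This gives an
`L²(μ)` bound that does not depend on the complexity.

The weighted bound is a sparse domination argument. On a cube `Q`, a subcube is stopped when the
average of `|f|` or of `|g|` over it exceeds four times that over `Q`; the stopped cubes fill at
most half of `Q` (`PartitionTree.IsStopping.sum_stopped_le`). The cubes `L` that are not stopped
contribute at most `C (m + n + 1) ⟨|f|⟩_Q ⟨|g|⟩_Q μ(Q)` (`PartitionTree.IsStopping.sum_form_le`):
where the cubes carrying the Haar functions have not been stopped either, the `L²` bound applies to
the stopped martingales, which are bounded by doubling; and a stopped cube lies within `m`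
generations below at most `m` of its ancestors, which accounts for the linear dependence on the
complexity. Induction over the generations then bounds the sum of all forms by `2 C (m + n + 1) ∫ Φ
dμ` for every function `Φ` that dominates the products `⟨|f|⟩_Q ⟨|g|⟩_Q` on `Q`
(`PartitionTree.IsShiftKernel.sum_form_le`).

With `σ = w⁻¹`, the product `⟨|f|⟩_Q ⟨|g|⟩_Q` is `⟨w⟩_Q ⟨σ⟩_Q`, which is at most `[w]_{A₂}`, times
the averages of `|f| / σ` with respect to `σ` and of `|g| / w` with respect to `w`. So `Φ` may be
taken to be `[w]_{A₂}` times the product of the two weighted dyadic maximal functions, and the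
Cauchy-Schwarz inequality together with Doob's inequality (`PartitionTree.sum_maxAvg_sq_le`) gives
the linear bound in `[w]_{A₂}`. The resulting dependence on the complexity is linear, hence at most
cubic.
-/

/-! ### Conditional expectations on a finite refining sequence of partitions -/

/-- A sequence of partitions of `Λ`, each refining the previous one. The `k`-th partition is given
by a labelling: two points lie in the same `k`-cell when they have the same `k`-th label. -/
structure PartitionTree (Λ α : Type*) where
  /-- the label of the `k`-cell of a point -/
  label : ℕ → Λ → α
  refine : ∀ k x y, label (k + 1) x = label (k + 1) y → label k x = label k y

namespace PartitionTree

variable {Λ α : Type*} (p : PartitionTree Λ α)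

lemma refine_le {j k : ℕ} (h : j ≤ k) {x y : Λ} (hxy : p.label k x = p.label k y) :
    p.label j x = p.label j y := by
  induction k, h using Nat.le_induction with
  | base => exact hxy
  | succ k _ ih => exact ih (p.refine k x y hxy)

/-- A function is `k`-invariant when it is constant on the `k`-cells. -/
def Invariant (k : ℕ) {V : Type*} (u : Λ → V) : Prop :=
  ∀ x y, p.label k x = p.label k y → u x = u y

variable {p} in
lemma Invariant.mono {V : Type*} {u : Λ → V} {j k : ℕ} (hu : p.Invariant j u) (h : j ≤ k) :
    p.Invariant k u := fun x y hxy => hu x y (p.refine_le h hxy)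

variable [Fintype Λ] {𝕜 : Type*} [RCLike 𝕜]

open Classical in
/-- The `k`-cell of `x`. -/
noncomputable def cell (k : ℕ) (x : Λ) : Finset Λ := univ.filter fun y => p.label k y = p.label k x

lemma mem_cell {k : ℕ} {x y : Λ} : y ∈ p.cell k x ↔ p.label k y = p.label k x := by
  simp [cell]

lemma self_mem_cell (k : ℕ) (x : Λ) : x ∈ p.cell k x := p.mem_cell.2 rfl

lemma cell_congr {k : ℕ} {x y : Λ} (h : p.label k x = p.label k y) : p.cell k x = p.cell k y := by
  ext z; simp [mem_cell, h]

lemma cell_anti {j k : ℕ} (h : j ≤ k) (x : Λ) : p.cell k x ⊆ p.cell j x := fun _ hy =>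
  p.mem_cell.2 (p.refine_le h (p.mem_cell.1 hy))

/-- The mass of the `k`-cell of `x`. -/
noncomputable def mass (ν : Λ → ℝ) (k : ℕ) (x : Λ) : ℝ := ∑ y ∈ p.cell k x, ν y

lemma mass_pos {ν : Λ → ℝ} (hν : ∀ x, 0 < ν x) (k : ℕ) (x : Λ) : 0 < p.mass ν k x :=
  sum_pos (fun y _ => hν y) ⟨x, p.self_mem_cell k x⟩

lemma mass_invariant (ν : Λ → ℝ) (k : ℕ) : p.Invariant k (p.mass ν k) := fun x y h => by
  simp [mass, p.cell_congr h]

/-- The conditional expectation of `u` on the `k`-th partition: the `ν`-average of `u` over the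
`k`-cell of `x`. -/
noncomputable def avg (ν : Λ → ℝ) (k : ℕ) (u : Λ → 𝕜) (x : Λ) : 𝕜 :=
  (p.mass ν k x)⁻¹ • ∑ y ∈ p.cell k x, ν y • u y

lemma avg_invariant (ν : Λ → ℝ) (k : ℕ) (u : Λ → 𝕜) : p.Invariant k (p.avg ν k u) :=
  fun x y h => by simp [avg, mass, p.cell_congr h]

lemma mass_smul_avg {ν : Λ → ℝ} (hν : ∀ x, 0 < ν x) (k : ℕ) (u : Λ → 𝕜) (x : Λ) :
    p.mass ν k x • p.avg ν k u x = ∑ y ∈ p.cell k x, ν y • u y := by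
  rw [avg, smul_inv_smul₀ (p.mass_pos hν k x).ne']

lemma mass_mul_avg {ν : Λ → ℝ} (hν : ∀ x, 0 < ν x) (k : ℕ) (u : Λ → ℝ) (x : Λ) :
    p.mass ν k x * p.avg ν k u x = ∑ y ∈ p.cell k x, ν y * u y :=
  p.mass_smul_avg hν k u x

lemma sum_cell_eq {V : Type*} [AddCommMonoid V] (k : ℕ) (x : Λ) (u : Λ → V) :
    open Classical in
    ∑ y ∈ p.cell k x, u y = ∑ y, if p.label k y = p.label k x then u y else 0 := by
  classical
  rw [cell, sum_filter]

/-- Conditional expectation is symmetric: a `k`-invariant factor may be pulled out. -/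
lemma sum_smul_mul_avg {ν : Λ → ℝ} (hν : ∀ x, 0 < ν x) {k : ℕ} {c : Λ → 𝕜} (hc : p.Invariant k c)
    (u : Λ → 𝕜) : ∑ x, ν x • (c x * p.avg ν k u x) = ∑ x, ν x • (c x * u x) := by
  classical
  have h1 : ∀ x, ν x • (c x * p.avg ν k u x) = ∑ y, if p.label k y = p.label k x then
      (ν x * (p.mass ν k y)⁻¹) • (ν y • (c y * u y)) else 0 := by
    intro x
    rw [avg, sum_cell_eq, smul_sum, mul_sum, smul_sum]
    refine sum_congr rfl fun y _ => ?_
    split_ifs with h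
    · rw [hc x y h.symm, p.mass_invariant ν k x y h.symm, mul_smul, mul_smul_comm, mul_smul_comm]
    · simp
  simp_rw [h1]
  rw [sum_comm]
  refine sum_congr rfl fun y _ => ?_
  have h2 : ∀ x, (if p.label k y = p.label k x then
      (ν x * (p.mass ν k y)⁻¹) • (ν y • (c y * u y)) else 0) =
      (if p.label k x = p.label k y then ν x else 0) •
        ((p.mass ν k y)⁻¹ • (ν y • (c y * u y))) := by
    intro x
    by_cases h : p.label k x = p.label k y
    · simp [h, mul_smul]
    · simp [h, Ne.symm h]
  simp_rw [h2]
  rw [← sum_smul, ← sum_cell_eq]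
  exact smul_inv_smul₀ (p.mass_pos hν k y).ne' _

lemma sum_mul_avg {ν : Λ → ℝ} (hν : ∀ x, 0 < ν x) {k : ℕ} {c : Λ → ℝ} (hc : p.Invariant k c)
    (u : Λ → ℝ) : ∑ x, ν x * (c x * p.avg ν k u x) = ∑ x, ν x * (c x * u x) :=
  p.sum_smul_mul_avg hν hc u

lemma avg_mono {ν : Λ → ℝ} (hν : ∀ x, 0 < ν x) (k : ℕ) {u v : Λ → ℝ} {x : Λ}
    (h : ∀ y ∈ p.cell k x, u y ≤ v y) : p.avg ν k u x ≤ p.avg ν k v x :=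
  smul_le_smul_of_nonneg_left (sum_le_sum fun y hy =>
    smul_le_smul_of_nonneg_left (h y hy) (hν y).le) (inv_nonneg.2 (p.mass_pos hν k x).le)

lemma avg_nonneg {ν : Λ → ℝ} (hν : ∀ x, 0 < ν x) (k : ℕ) {u : Λ → ℝ} (hu : ∀ y, 0 ≤ u y) (x : Λ) :
    0 ≤ p.avg ν k u x :=
  smul_nonneg (inv_nonneg.2 (p.mass_pos hν k x).le) (sum_nonneg fun y _ =>
    smul_nonneg (hν y).le (hu y))

lemma norm_avg_le {ν : Λ → ℝ} (hν : ∀ x, 0 < ν x) (k : ℕ) (u : Λ → 𝕜) (x : Λ) :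
    ‖p.avg ν k u x‖ ≤ p.avg ν k (fun y => ‖u y‖) x := by
  rw [avg, avg, norm_smul, Real.norm_of_nonneg (inv_nonneg.2 (p.mass_pos hν k x).le), smul_eq_mul]
  refine mul_le_mul_of_nonneg_left ((norm_sum_le _ _).trans (sum_le_sum fun y _ => ?_))
    (inv_nonneg.2 (p.mass_pos hν k x).le)
  rw [norm_smul, Real.norm_of_nonneg (hν y).le, smul_eq_mul]

/-- Jensen's inequality for the square. -/
lemma avg_sq_le {ν : Λ → ℝ} (hν : ∀ x, 0 < ν x) (k : ℕ) (u : Λ → ℝ) (x : Λ) :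
    p.avg ν k u x ^ 2 ≤ p.avg ν k (fun y => u y ^ 2) x := by
  have hm := p.mass_pos hν k x
  have h := sum_sq_le_sum_mul_sum_of_sq_le_mul (p.cell k x) (r := fun y => ν y * u y)
    (f := fun y => ν y) (g := fun y => ν y * u y ^ 2) (fun y _ => (hν y).le)
    (fun y _ => mul_nonneg (hν y).le (sq_nonneg _)) (fun y _ => le_of_eq (by ring))
  rw [← p.mass_mul_avg hν, ← p.mass_mul_avg hν, mul_pow, sq (p.mass ν k x), mul_assoc] at h
  exact le_of_mul_le_mul_left ((mul_le_mul_iff_right₀ hm).1 (by simpa [mass] using h)) hm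

/-- Martingale differences: the conditional variance identity. -/
lemma sum_mul_norm_sub_sq {ν : Λ → ℝ} (hν : ∀ x, 0 < ν x) {i : ℕ} {c : Λ → ℝ}
    (hc : p.Invariant i c) (u : Λ → 𝕜) :
    ∑ x, ν x * (c x * ‖p.avg ν (i + 1) u x - p.avg ν i u x‖ ^ 2) =
      ∑ x, ν x * (c x * (‖p.avg ν (i + 1) u x‖ ^ 2 - ‖p.avg ν i u x‖ ^ 2)) := by
  have hd : p.Invariant i fun x => (c x : 𝕜) * (starRingEnd 𝕜) (p.avg ν i u x) := fun x y h => by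
    simp only [hc x y h, p.avg_invariant ν i u x y h]
  have h1 := (p.sum_smul_mul_avg hν (hd.mono i.le_succ) u).trans (p.sum_smul_mul_avg hν hd u).symm
  have h2 := congrArg (RCLike.re (K := 𝕜)) h1
  simp only [map_sum, RCLike.smul_re, mul_assoc, RCLike.re_ofReal_mul] at h2
  have h3 : ∀ x, ‖p.avg ν (i + 1) u x - p.avg ν i u x‖ ^ 2 =
      ‖p.avg ν (i + 1) u x‖ ^ 2 - ‖p.avg ν i u x‖ ^ 2 -
      2 * (RCLike.re ((starRingEnd 𝕜) (p.avg ν i u x) * p.avg ν (i + 1) u x) -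
        RCLike.re ((starRingEnd 𝕜) (p.avg ν i u x) * p.avg ν i u x)) := by
    intro x
    rw [RCLike.conj_mul, ← RCLike.ofReal_pow, RCLike.ofReal_re]
    have := norm_sub_sq (𝕜 := 𝕜) (p.avg ν (i + 1) u x) (p.avg ν i u x)
    rw [this, ← RCLike.conj_re (inner _ _ _)]
    simp only [RCLike.inner_apply, map_mul, RCLike.conj_conj]
    ring
  rw [← sub_eq_zero, ← sum_sub_distrib]
  rw [← sub_eq_zero, ← sum_sub_distrib] at h2
  rw [← mul_eq_zero_of_right (-2 : ℝ) h2, mul_sum]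
  refine sum_congr rfl fun x _ => ?_
  rw [h3]; ring

/-- The maximal function over the first `N + 1` partitions, as a running maximum. -/
noncomputable def maxAvg (ν : Λ → ℝ) (u : Λ → ℝ) : ℕ → Λ → ℝ
  | 0 => p.avg ν 0 u
  | k + 1 => fun x => max (maxAvg ν u k x) (p.avg ν (k + 1) u x)

lemma avg_le_maxAvg (ν : Λ → ℝ) (u : Λ → ℝ) {k N : ℕ} (h : k ≤ N) (x : Λ) :
    p.avg ν k u x ≤ p.maxAvg ν u N x := by
  induction N, h using Nat.le_induction with
  | base => cases k with
    | zero => exact le_rfl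
    | succ k => exact le_max_right _ _
  | succ N _ ih => exact ih.trans (le_max_left _ _)

lemma maxAvg_invariant (ν : Λ → ℝ) (u : Λ → ℝ) (k : ℕ) : p.Invariant k (p.maxAvg ν u k) := by
  induction k with
  | zero => exact p.avg_invariant ν 0 u
  | succ k ih =>
    intro x y h
    simp only [maxAvg, (ih.mono k.le_succ) x y h, p.avg_invariant ν (k + 1) u x y h]

/-- Doob's maximal inequality in `L²`. With `s` the martingale and `s*` its running maximum,
`2 s* s - (s*) ^ 2` is a submartingale starting from `s 0 ^ 2 ≥ 0`. -/
theorem sum_maxAvg_sq_le {ν : Λ → ℝ} (hν : ∀ x, 0 < ν x) (u : Λ → ℝ) (N : ℕ) :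
    ∑ x, ν x * p.maxAvg ν u N x ^ 2 ≤ 4 * ∑ x, ν x * u x ^ 2 := by
  have key : ∀ k, 0 ≤ ∑ x, ν x * (2 * p.maxAvg ν u k x * p.avg ν k u x - p.maxAvg ν u k x ^ 2) := by
    intro k
    induction k with
    | zero =>
      refine sum_nonneg fun x _ => mul_nonneg (hν x).le ?_
      simp only [maxAvg]; nlinarith [sq_nonneg (p.avg ν 0 u x)]
    | succ k ih =>
      have hI := p.maxAvg_invariant ν u k
      have h1 := (p.sum_mul_avg hν (hI.mono k.le_succ) u).trans (p.sum_mul_avg hν hI u).symm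
      have h2 : ∑ x, ν x * (2 * p.maxAvg ν u k x * p.avg ν k u x - p.maxAvg ν u k x ^ 2) =
          ∑ x, ν x * (2 * p.maxAvg ν u k x * p.avg ν (k + 1) u x - p.maxAvg ν u k x ^ 2) := by
        simp only [mul_sub, sum_sub_distrib]
        congr 1
        have := congrArg (2 * ·) h1
        simp only [mul_sum] at this
        rw [← sum_congr rfl fun x _ => (by ring : 2 * (ν x * (p.maxAvg ν u k x * p.avg ν k u x)) =
            ν x * (2 * p.maxAvg ν u k x * p.avg ν k u x)), ← this]
        exact sum_congr rfl fun x _ => by ring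
      rw [h2] at ih
      refine ih.trans (sum_le_sum fun x _ => mul_le_mul_of_nonneg_left ?_ (hν x).le)
      simp only [maxAvg]
      rcases le_total (p.maxAvg ν u k x) (p.avg ν (k + 1) u x) with h | h
      · rw [max_eq_right h]; nlinarith [sq_nonneg (p.avg ν (k + 1) u x - p.maxAvg ν u k x)]
      · rw [max_eq_left h]
  have h1 := p.sum_mul_avg hν (p.maxAvg_invariant ν u N) u
  have h2 : 0 ≤ ∑ x, ν x * (2 * p.maxAvg ν u N x * u x - p.maxAvg ν u N x ^ 2) := by
    refine (key N).trans_eq ?_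
    simp only [mul_sub, sum_sub_distrib]
    congr 1
    have := congrArg (2 * ·) h1
    simp only [mul_sum] at this
    rw [← sum_congr rfl fun x _ => (by ring : 2 * (ν x * (p.maxAvg ν u N x * p.avg ν N u x)) =
            ν x * (2 * p.maxAvg ν u N x * p.avg ν N u x)), this]
    exact sum_congr rfl fun x _ => by ring
  have h3 : ∑ x, ν x * (2 * p.maxAvg ν u N x * u x - p.maxAvg ν u N x ^ 2) ≤
      ∑ x, ν x * (2 * u x ^ 2 - p.maxAvg ν u N x ^ 2 / 2) :=
    sum_le_sum fun x _ => mul_le_mul_of_nonneg_left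
      (by nlinarith [sq_nonneg (2 * u x - p.maxAvg ν u N x)]) (hν x).le
  have h4 : ∑ x, ν x * (2 * u x ^ 2 - p.maxAvg ν u N x ^ 2 / 2) =
      2 * ∑ x, ν x * u x ^ 2 - (∑ x, ν x * p.maxAvg ν u N x ^ 2) / 2 := by
    rw [mul_sum, sum_div, ← sum_sub_distrib]
    exact sum_congr rfl fun x _ => by ring
  linarith

end PartitionTree

/-! ### Kernels with cancellation -/

namespace PartitionTree

variable {Λ α : Type*} [Fintype Λ] (p : PartitionTree Λ α) {𝕜 : Type*} [RCLike 𝕜]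

/-- The kernels of a dyadic shift of complexity `(m, n)`, seen on the tree: `a k x y` is at most
`C₀ / μ(L)` on each `k`-cell `L`; as a function of `y` it is constant on the `(k + m + 1)`-cells
and has mean zero on the `(k + m)`-cells, and likewise in `x` with `n` in place of `m`. -/
structure IsShiftKernel (μ : Λ → ℝ) (C₀ : ℝ) (m n : ℕ) (a : ℕ → Λ → Λ → 𝕜) : Prop where
  bound : ∀ k x y, p.label k y = p.label k x → ‖a k x y‖ ≤ C₀ / p.mass μ k x
  invariant_right : ∀ k x, p.Invariant (k + m + 1) (a k x)
  invariant_left : ∀ k y, p.Invariant (k + n + 1) fun x => a k x y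
  cancel_right : ∀ k x y₀, ∑ y ∈ p.cell (k + m) y₀, μ y • a k x y = 0
  cancel_left : ∀ k y x₀, ∑ x ∈ p.cell (k + n) x₀, μ x • a k x y = 0

/-- The bilinear form of the kernel `a k` on the `k`-cell of `x₀`. -/
noncomputable def form (μ : Λ → ℝ) (a : ℕ → Λ → Λ → 𝕜) (k : ℕ) (u v : Λ → 𝕜) (x₀ : Λ) : 𝕜 :=
  ∑ x ∈ p.cell k x₀, ∑ y ∈ p.cell k x₀, (μ x * μ y) • (a k x y * u y * v x)

variable {p} {μ : Λ → ℝ} {C₀ : ℝ} {m n : ℕ} {a : ℕ → Λ → Λ → 𝕜}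

lemma IsShiftKernel.swap (ha : p.IsShiftKernel μ C₀ m n a) :
    p.IsShiftKernel μ C₀ n m fun k x y => a k y x where
  bound k x y h := by
    rw [← p.mass_invariant μ k y x h]
    exact ha.bound k y x h.symm
  invariant_right := ha.invariant_left
  invariant_left := ha.invariant_right
  cancel_right := ha.cancel_left
  cancel_left := ha.cancel_right

variable (p) in
lemma form_swap (k : ℕ) (u v : Λ → 𝕜) (x₀ : Λ) :
    p.form μ (fun k x y => a k y x) k v u x₀ = p.form μ a k u v x₀ := by
  rw [form, form, sum_comm]
  refine sum_congr rfl fun x _ => sum_congr rfl fun y _ => ?_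
  rw [mul_comm (μ y), mul_right_comm]

variable (p) in
lemma form_congr {k : ℕ} {u u' v v' : Λ → 𝕜} {x₀ : Λ} (hu : ∀ y ∈ p.cell k x₀, u y = u' y)
    (hv : ∀ y ∈ p.cell k x₀, v y = v' y) : p.form μ a k u v x₀ = p.form μ a k u' v' x₀ :=
  sum_congr rfl fun x hx => sum_congr rfl fun y hy => by rw [hu y hy, hv x hx]

variable (p) in
lemma form_add_left (k : ℕ) (u u' v : Λ → 𝕜) (x₀ : Λ) :
    p.form μ a k (fun y => u y + u' y) v x₀ = p.form μ a k u v x₀ + p.form μ a k u' v x₀ := by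
  simp only [form, ← sum_add_distrib]
  exact sum_congr rfl fun x _ => sum_congr rfl fun y _ => by rw [← smul_add]; ring_nf

variable (p) in
lemma form_add_right (k : ℕ) (u v v' : Λ → 𝕜) (x₀ : Λ) :
    p.form μ a k u (fun y => v y + v' y) x₀ = p.form μ a k u v x₀ + p.form μ a k u v' x₀ := by
  simp only [form, ← sum_add_distrib]
  exact sum_congr rfl fun x _ => sum_congr rfl fun y _ => by rw [← smul_add]; ring_nf

/-- The size estimate for the form, which ignores cancellation. -/
lemma IsShiftKernel.norm_form_div_le (ha : p.IsShiftKernel μ C₀ m n a) (hμ : ∀ x, 0 < μ x)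
    (k : ℕ) (u v : Λ → 𝕜) (x₀ : Λ) :
    ‖p.form μ a k u v x₀‖ / p.mass μ k x₀ ≤
      C₀ * (p.avg μ k (fun y => ‖u y‖) x₀ * p.avg μ k (fun y => ‖v y‖) x₀) := by
  have hm := p.mass_pos hμ k x₀
  have h : ‖p.form μ a k u v x₀‖ ≤ C₀ / p.mass μ k x₀ *
      ((∑ y ∈ p.cell k x₀, μ y * ‖u y‖) * ∑ x ∈ p.cell k x₀, μ x * ‖v x‖) := by
    rw [sum_mul_sum, sum_comm, mul_sum]
    refine (norm_sum_le _ _).trans (sum_le_sum fun x hx => ?_)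
    rw [mul_sum]
    refine (norm_sum_le _ _).trans (sum_le_sum fun y hy => ?_)
    rw [norm_smul, Real.norm_of_nonneg (mul_pos (hμ x) (hμ y)).le, norm_mul, norm_mul]
    have hx' := p.mem_cell.1 hx
    have hb := ha.bound k x y ((p.mem_cell.1 hy).trans hx'.symm)
    rw [p.mass_invariant μ k x x₀ hx'] at hb
    calc μ x * μ y * (‖a k x y‖ * ‖u y‖ * ‖v x‖)
        = ‖a k x y‖ * (μ y * ‖u y‖ * (μ x * ‖v x‖)) := by ring
      _ ≤ _ := mul_le_mul_of_nonneg_right hb (by have := hμ x; have := hμ y; positivity)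
  rw [← p.mass_mul_avg hμ, ← p.mass_mul_avg hμ] at h
  rw [div_le_iff₀ hm]
  refine h.trans_eq ?_
  field_simp

/-- Against a function that is constant on the `(i + 1)`-cells and has mean zero on the `i`-cells,
`u` may be replaced by its martingale difference. -/
lemma sum_smul_mul_martingaleDiff (hμ : ∀ x, 0 < μ x) {i : ℕ} {c : Λ → 𝕜}
    (hc : p.Invariant (i + 1) c) (h0 : ∀ y₀, ∑ y ∈ p.cell i y₀, μ y • c y = 0) (u : Λ → 𝕜) :
    ∑ x, μ x • (c x * u x) = ∑ x, μ x • (c x * (p.avg μ (i + 1) u x - p.avg μ i u x)) := by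
  have h1 : ∑ x, μ x • (c x * p.avg μ i u x) = 0 := by
    have := p.sum_smul_mul_avg hμ (p.avg_invariant μ i u) c
    simp only [mul_comm (c _), ← this]
    exact sum_eq_zero fun x _ => by rw [avg, avg, h0]; simp
  simp only [mul_sub, smul_sub, sum_sub_distrib, h1, sub_zero]
  exact (p.sum_smul_mul_avg hμ hc u).symm

lemma IsShiftKernel.form_eq_diff_left (ha : p.IsShiftKernel μ C₀ m n a) (hμ : ∀ x, 0 < μ x)
    {k : ℕ} {q : Λ → ℝ} (hq : p.Invariant (k + m) q) (u v : Λ → 𝕜) (x₀ : Λ) :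
    p.form μ a k (fun y => q y • u y) v x₀ =
      p.form μ a k (fun y => q y • (p.avg μ (k + m + 1) u y - p.avg μ (k + m) u y)) v x₀ := by
  classical
  refine sum_congr rfl fun x _ => ?_
  -- For fixed `x`, all factors other than the kernel and `u` form a `(k + m)`-invariant function.
  set e : Λ → 𝕜 := fun y => if p.label k y = p.label k x₀ then q y • v x else 0 with he
  have hei : p.Invariant (k + m) e := fun y z h => by
    simp only [he, p.refine_le (Nat.le_add_right k m) h, hq y z h]
  have h1 : ∀ w : Λ → 𝕜, ∑ y ∈ p.cell k x₀, (μ x * μ y) • (a k x y * (q y • w y) * v x) =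
      μ x • ∑ y, μ y • (e y * a k x y * w y) := by
    intro w
    rw [sum_cell_eq, smul_sum]
    refine sum_congr rfl fun y _ => ?_
    simp only [he]
    split_ifs
    · rw [mul_smul]; congr 2
      simp only [mul_smul_comm, smul_mul_assoc]; congr 1; ring
    · simp
  rw [h1, h1]
  congr 1
  refine sum_smul_mul_martingaleDiff hμ (fun y z h => ?_) (fun y₀ => ?_) u
  · simp only [hei.mono (Nat.le_succ _) y z h, ha.invariant_right k x y z h]
  · calc ∑ y ∈ p.cell (k + m) y₀, μ y • (e y * a k x y)
        = ∑ y ∈ p.cell (k + m) y₀, e y₀ * (μ y • a k x y) := sum_congr rfl fun y hy => by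
          rw [hei y y₀ (p.mem_cell.1 hy), mul_smul_comm]
      _ = 0 := by rw [← mul_sum, ha.cancel_right, mul_zero]

lemma IsShiftKernel.form_eq_diff_right (ha : p.IsShiftKernel μ C₀ m n a) (hμ : ∀ x, 0 < μ x)
    {k : ℕ} {q : Λ → ℝ} (hq : p.Invariant (k + n) q) (u v : Λ → 𝕜) (x₀ : Λ) :
    p.form μ a k u (fun y => q y • v y) x₀ =
      p.form μ a k u (fun y => q y • (p.avg μ (k + n + 1) v y - p.avg μ (k + n) v y)) x₀ := by
  rw [← form_swap, ha.swap.form_eq_diff_left hμ hq, form_swap]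

/-! ### Sequences that decrease at a stopping time -/

lemma sum_mul_sub_le_of_antitone {s e : ℕ → ℝ} {V : ℝ} (hs : Antitone s)
    (h01 : ∀ k, s k = 0 ∨ s k = 1) {j : ℕ} (h : ∀ i, j ≤ i → s i = 1 → e i ≤ V)
    (h' : ∀ i, j ≤ i → s i = 1 → e (i + 1) ≤ V) (N : ℕ) :
    ∑ i ∈ Ico j N, s i * (e (i + 1) - e i) ≤ s j * (V - e j) := by
  have h0 : 0 ≤ s j * (V - e j) := by
    rcases h01 j with h0 | h1
    · simp [h0]
    · rw [h1, one_mul, sub_nonneg]; exact h j le_rfl h1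
  induction hd : N - j generalizing j with
  | zero => rw [Ico_eq_empty_of_le (by omega), sum_empty]; exact h0
  | succ d ih =>
    rw [sum_eq_sum_Ico_succ_bot (by omega)]
    have h0' : 0 ≤ s (j + 1) * (V - e (j + 1)) := by
      rcases h01 (j + 1) with h0 | h1
      · simp [h0]
      · rw [h1, one_mul, sub_nonneg]; exact h (j + 1) (by omega) h1
    have := ih (j := j + 1) (fun i hi => h i (by omega)) (fun i hi => h' i (by omega)) h0'
      (by omega)
    rcases h01 j with h0 | h1
    · have h2 : s (j + 1) = 0 := by
        rcases h01 (j + 1) with h2 | h2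
        · exact h2
        · have := hs j.le_succ; rw [h0, Nat.succ_eq_add_one, h2] at this; linarith
      rw [h2] at this; rw [h0]; linarith
    · have h3 := h' j le_rfl h1
      have h4 : s (j + 1) * (V - e (j + 1)) ≤ V - e (j + 1) := by
        rcases h01 (j + 1) with h2 | h2 <;> rw [h2] <;> linarith
      rw [h1]; linarith

lemma sum_sub_shift_le_of_antitone {s : ℕ → ℝ} (hs : Antitone s) (h0 : ∀ k, 0 ≤ s k) (j N m : ℕ) :
    ∑ k ∈ Ico j N, (s k - s (k + m)) ≤ m * s j := by
  induction m with
  | zero => simp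
  | succ m ih =>
    have h1 : ∑ k ∈ Ico j N, (s (k + m) - s (k + (m + 1))) ≤ s j := by
      rcases le_total N j with h | h
      · rw [Ico_eq_empty_of_le h, sum_empty]; exact h0 j
      · have := sum_Ico_sub (fun k => -s (k + m)) h
        simp only [neg_sub_neg, Nat.add_right_comm _ 1 m] at this
        simp only [← add_assoc]
        rw [this]
        linarith [h0 (N + m), hs (Nat.le_add_right j m)]
    calc ∑ k ∈ Ico j N, (s k - s (k + (m + 1)))
        = ∑ k ∈ Ico j N, (s k - s (k + m)) + ∑ k ∈ Ico j N, (s (k + m) - s (k + (m + 1))) := by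
          rw [← sum_add_distrib]; exact sum_congr rfl fun k _ => by ring
      _ ≤ _ := by push_cast; linarith

/-- Summation by parts: the terms beyond a stopping time are grouped by its value. -/
lemma sum_sub_mul_eq (s b : ℕ → ℝ) (j N : ℕ) :
    ∑ k ∈ Ico j N, (s j - s k) * b k =
      ∑ t ∈ Ico j N, (s t - s (t + 1)) * ∑ k ∈ Ico (t + 1) N, b k := by
  have h : ∀ k ∈ Ico j N, (s j - s k) * b k = ∑ t ∈ Ico j k, (s t - s (t + 1)) * b k := by
    intro k hk
    have := sum_Ico_sub (fun k => -s k) (mem_Ico.1 hk).1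
    simp only [neg_sub_neg] at this
    rw [← sum_mul, this]
  rw [sum_congr rfl h]
  simp only [mul_sum]
  refine sum_comm' fun k t => ?_
  simp only [mem_Ico]; omega

end PartitionTree

/-! ### The stopping time estimate -/

namespace PartitionTree

variable {Λ α : Type*} {p : PartitionTree Λ α} {𝕜 : Type*} [RCLike 𝕜]
variable {μ : Λ → ℝ} {C₀ : ℝ} {m n : ℕ} {a : ℕ → Λ → Λ → 𝕜}

/-- A stopping time that starts at generation `j`: `s k x` is `1` as long as the `k`-cell of `x`
has not been stopped and `0` afterwards. -/
structure IsStopping (p : PartitionTree Λ α) (j : ℕ) (s : ℕ → Λ → ℝ) : Prop where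
  zero_or_one : ∀ k x, s k x = 0 ∨ s k x = 1
  anti : ∀ x, Antitone fun k => s k x
  invariant : ∀ k, j ≤ k → p.Invariant k (s k)

namespace IsStopping

variable {j : ℕ} {s : ℕ → Λ → ℝ}

lemma nonneg (hs : p.IsStopping j s) (k : ℕ) (x : Λ) : 0 ≤ s k x := by
  rcases hs.zero_or_one k x with h | h <;> simp [h]

lemma shift_nonneg (hs : p.IsStopping j s) {k l : ℕ} (h : k ≤ l) (x : Λ) : 0 ≤ s k x - s l x :=
  sub_nonneg.2 (hs.anti x h)

lemma one_of_le (hs : p.IsStopping j s) {k l : ℕ} (h : k ≤ l) {x : Λ} (h1 : s l x = 1) :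
    s k x = 1 := by
  rcases hs.zero_or_one k x with h2 | h2
  · have := hs.anti x h
    simp only [h1, h2] at this; linarith
  · exact h2

variable [Fintype Λ]

/-- A square function bound: before the stopping time the averages of `f` are at most
`4 α₁`, so that by doubling the stopped martingale is at most `4 B α₁`. -/
lemma sum_sq_le (hs : p.IsStopping j s) (hμ : ∀ x, 0 < μ x) {B : ℝ} (hB : 1 ≤ B)
    (hdoub : ∀ k x, p.mass μ k x ≤ B * p.mass μ (k + 1) x) (f : Λ → 𝕜) {α₁ : ℝ} (hα : 0 ≤ α₁)
    (hf : ∀ k, j ≤ k → ∀ x, s k x = 1 → p.avg μ k (fun y => ‖f y‖) x ≤ 4 * α₁) (N m : ℕ) :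
    ∑ k ∈ Ico j N, ∑ x, μ x *
        (s (k + m) x * ‖p.avg μ (k + m + 1) f x - p.avg μ (k + m) f x‖ ^ 2) ≤
      (4 * B * α₁) ^ 2 * ∑ x, μ x * s j x := by
  have h1 : ∑ k ∈ Ico j N, ∑ x, μ x *
        (s (k + m) x * ‖p.avg μ (k + m + 1) f x - p.avg μ (k + m) f x‖ ^ 2) ≤
      ∑ i ∈ Ico j (N + m), ∑ x, μ x *
        (s i x * ‖p.avg μ (i + 1) f x - p.avg μ i f x‖ ^ 2) := by
    rw [sum_Ico_add' (fun i => ∑ x, μ x *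
        (s i x * ‖p.avg μ (i + 1) f x - p.avg μ i f x‖ ^ 2)) j N m]
    refine sum_le_sum_of_subset_of_nonneg (Ico_subset_Ico_left (by omega)) fun i _ _ => ?_
    exact sum_nonneg fun x _ => mul_nonneg (hμ x).le (mul_nonneg (hs.nonneg _ _) (sq_nonneg _))
  refine h1.trans ?_
  rw [sum_congr rfl fun i hi => p.sum_mul_norm_sub_sq hμ (hs.invariant i (mem_Ico.1 hi).1) f,
    sum_comm, mul_sum]
  refine sum_le_sum fun x _ => ?_
  rw [← mul_sum, mul_left_comm]
  refine mul_le_mul_of_nonneg_left ?_ (hμ x).le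
  have hsucc : ∀ i, p.avg μ (i + 1) (fun y => ‖f y‖) x ≤ B * p.avg μ i (fun y => ‖f y‖) x := by
    intro i
    have hm := p.mass_pos hμ (i + 1) x
    refine le_of_mul_le_mul_left ?_ hm
    rw [p.mass_mul_avg hμ]
    calc ∑ y ∈ p.cell (i + 1) x, μ y * ‖f y‖ ≤ ∑ y ∈ p.cell i x, μ y * ‖f y‖ :=
          sum_le_sum_of_subset_of_nonneg (p.cell_anti i.le_succ x) fun y _ _ =>
            mul_nonneg (hμ y).le (norm_nonneg _)
      _ = p.mass μ i x * p.avg μ i (fun y => ‖f y‖) x := (p.mass_mul_avg hμ i _ x).symm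
      _ ≤ (B * p.mass μ (i + 1) x) * p.avg μ i (fun y => ‖f y‖) x :=
          mul_le_mul_of_nonneg_right (hdoub i x) (p.avg_nonneg hμ i (fun _ => norm_nonneg _) x)
      _ = _ := by ring
  have := sum_mul_sub_le_of_antitone (s := fun k => s k x) (e := fun i => ‖p.avg μ i f x‖ ^ 2)
    (V := (4 * B * α₁) ^ 2) (hs.anti x) (fun k => hs.zero_or_one k x) (j := j)
    (fun i hi h => pow_le_pow_left₀ (norm_nonneg _) ((p.norm_avg_le hμ i f x).trans
      ((hf i hi x h).trans (by nlinarith))) 2)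
    (fun i hi h => pow_le_pow_left₀ (norm_nonneg _) ((p.norm_avg_le hμ (i + 1) f x).trans
      ((hsucc i).trans (by nlinarith [hf i hi x h]))) 2) (N + m)
  refine this.trans ?_
  nlinarith [hs.nonneg j x, mul_nonneg (hs.nonneg j x) (sq_nonneg ‖p.avg μ j f x‖)]

/-- A cell is stopped within `m` generations of only `m` of its ancestors. -/
lemma sum_shift_le (hs : p.IsStopping j s) (hμ : ∀ x, 0 < μ x) (u : Λ → ℝ) (hu : ∀ x, 0 ≤ u x)
    (N m : ℕ) : ∑ k ∈ Ico j N, ∑ x, μ x * ((s k x - s (k + m) x) * u x) ≤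
      m * ∑ x, μ x * (s j x * u x) := by
  rw [sum_comm, mul_sum]
  refine sum_le_sum fun x _ => ?_
  rw [← mul_sum, ← sum_mul, mul_left_comm (m : ℝ), ← mul_assoc (m : ℝ)]
  exact mul_le_mul_of_nonneg_left (mul_le_mul_of_nonneg_right
    (sum_sub_shift_le_of_antitone (hs.anti x) (fun k => hs.nonneg k x) j N m) (hu x)) (hμ x).le

/-- The form on a cell that has not been stopped. Where the cells `m` (for `f`) and `n` (for `g`)
generations further down have not been stopped either, `f` and `g` enter through their martingale
differences; elsewhere they are estimated by size. -/
lemma form_le (hs : p.IsStopping j s) (hμ : ∀ x, 0 < μ x) (ha : p.IsShiftKernel μ C₀ m n a)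
    (hC₀ : 0 ≤ C₀) (f g : Λ → 𝕜) {α₁ β₁ : ℝ} (hα : 0 < α₁) (hβ : 0 < β₁)
    (hf : ∀ k, j ≤ k → ∀ x, s k x = 1 → p.avg μ k (fun y => ‖f y‖) x ≤ 4 * α₁)
    (hg : ∀ k, j ≤ k → ∀ x, s k x = 1 → p.avg μ k (fun y => ‖g y‖) x ≤ 4 * β₁)
    {k : ℕ} (hk : j ≤ k) (x : Λ) :
    s k x * (‖p.form μ a k f g x‖ / p.mass μ k x) ≤ C₀ *
      (β₁ / α₁ / 2 * (s k x * p.avg μ k (fun y => s (k + m) y *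
          ‖p.avg μ (k + m + 1) f y - p.avg μ (k + m) f y‖ ^ 2) x) +
        α₁ / β₁ / 2 * (s k x * p.avg μ k (fun y => s (k + n) y *
          ‖p.avg μ (k + n + 1) g y - p.avg μ (k + n) g y‖ ^ 2) x) +
        4 * β₁ * (s k x * p.avg μ k (fun y => (s k y - s (k + m) y) * ‖f y‖) x) +
        4 * α₁ * (s k x * p.avg μ k (fun y => (s k y - s (k + n) y) * ‖g y‖) x)) := by
  rcases hs.zero_or_one k x with h0 | h1
  · simp [h0]
  simp only [h1, one_mul]
  set Df : Λ → 𝕜 := fun y => p.avg μ (k + m + 1) f y - p.avg μ (k + m) f y with hDf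
  set Dg : Λ → 𝕜 := fun y => p.avg μ (k + n + 1) g y - p.avg μ (k + n) g y with hDg
  have hsk : ∀ y ∈ p.cell k x, s k y = 1 := fun y hy => by
    rw [hs.invariant k hk y x (p.mem_cell.1 hy), h1]
  have hfs : ∀ y ∈ p.cell k x, f y = s (k + m) y • f y + (s k y - s (k + m) y) • f y :=
    fun y hy => by rw [← add_smul, hsk y hy]; simp
  have hgs : ∀ y ∈ p.cell k x, g y = s (k + n) y • g y + (s k y - s (k + n) y) • g y :=
    fun y hy => by rw [← add_smul, hsk y hy]; simp
  have hdec : p.form μ a k f g x =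
      p.form μ a k (fun y => s (k + m) y • Df y) (fun y => s (k + n) y • Dg y) x +
      p.form μ a k (fun y => s (k + m) y • f y) (fun y => (s k y - s (k + n) y) • g y) x +
      p.form μ a k (fun y => (s k y - s (k + m) y) • f y) g x := by
    rw [p.form_congr hfs (fun _ _ => rfl), form_add_left]
    congr 1
    rw [p.form_congr (fun _ _ => rfl) hgs, form_add_right]
    congr 1
    rw [ha.form_eq_diff_left hμ (hs.invariant _ (by omega)),
      ha.form_eq_diff_right hμ (hs.invariant _ (by omega))]
  have hm := p.mass_pos hμ k x
  have hnorm : ‖p.form μ a k f g x‖ / p.mass μ k x ≤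
      C₀ * (p.avg μ k (fun y => ‖s (k + m) y • Df y‖) x *
        p.avg μ k (fun y => ‖s (k + n) y • Dg y‖) x) +
      C₀ * (p.avg μ k (fun y => ‖s (k + m) y • f y‖) x *
        p.avg μ k (fun y => ‖(s k y - s (k + n) y) • g y‖) x) +
      C₀ * (p.avg μ k (fun y => ‖(s k y - s (k + m) y) • f y‖) x *
        p.avg μ k (fun y => ‖g y‖) x) := by
    rw [hdec]
    refine (div_le_div_of_nonneg_right (norm_add₃_le) hm.le).trans ?_
    rw [add_div, add_div]
    exact add_le_add_three (ha.norm_form_div_le hμ _ _ _ _) (ha.norm_form_div_le hμ _ _ _ _)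
      (ha.norm_form_div_le hμ _ _ _ _)
  refine hnorm.trans ?_
  rw [← mul_add, ← mul_add]
  refine mul_le_mul_of_nonneg_left ?_ hC₀
  have hsq : ∀ (l : ℕ) (D : Λ → 𝕜), p.avg μ k (fun y => ‖s l y • D y‖) x ^ 2 ≤
      p.avg μ k (fun y => s l y * ‖D y‖ ^ 2) x := by
    intro l D
    refine (p.avg_sq_le hμ k _ x).trans (p.avg_mono hμ k fun y _ => ?_)
    rw [norm_smul, Real.norm_of_nonneg (hs.nonneg l y), mul_pow]
    rcases hs.zero_or_one l y with h | h <;> simp [h]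
  have hshift : ∀ (l : ℕ) (u : Λ → 𝕜), k ≤ l → p.avg μ k (fun y => ‖(s k y - s l y) • u y‖) x =
      p.avg μ k (fun y => (s k y - s l y) * ‖u y‖) x := by
    intro l u hl
    congr 1
    funext y
    rw [norm_smul, Real.norm_of_nonneg (hs.shift_nonneg hl y)]
  -- The weights `β₁ / α₁` and `α₁ / β₁` turn bounds `α₁ ^ 2` and `β₁ ^ 2` for the two square
  -- functions into a multiple of `α₁ * β₁`.
  have hA : ∀ P Q : ℝ, P * Q ≤ β₁ / α₁ / 2 * P ^ 2 + α₁ / β₁ / 2 * Q ^ 2 := by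
    intro P Q
    have : β₁ / α₁ / 2 * P ^ 2 + α₁ / β₁ / 2 * Q ^ 2 - P * Q =
        (β₁ * P - α₁ * Q) ^ 2 / (2 * α₁ * β₁) := by field_simp; ring
    have h2 : 0 ≤ (β₁ * P - α₁ * Q) ^ 2 / (2 * α₁ * β₁) := by positivity
    linarith
  have hf4 : p.avg μ k (fun y => ‖s (k + m) y • f y‖) x ≤ 4 * α₁ := by
    refine (p.avg_mono hμ k fun y _ => ?_).trans (hf k hk x h1)
    rw [norm_smul, Real.norm_of_nonneg (hs.nonneg _ y)]
    rcases hs.zero_or_one (k + m) y with h | h <;> simp [h]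
  rw [hshift (k + n) g (by omega), hshift (k + m) f (by omega)]
  have hn1 : 0 ≤ p.avg μ k (fun y => (s k y - s (k + n) y) * ‖g y‖) x := p.avg_nonneg hμ k
    (fun y => mul_nonneg (hs.shift_nonneg (by omega) y) (norm_nonneg _)) x
  have hn2 : 0 ≤ p.avg μ k (fun y => (s k y - s (k + m) y) * ‖f y‖) x := p.avg_nonneg hμ k
    (fun y => mul_nonneg (hs.shift_nonneg (by omega) y) (norm_nonneg _)) x
  have e1 := mul_le_mul_of_nonneg_left (hsq (k + m) Df) (by positivity : 0 ≤ β₁ / α₁ / 2)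
  have e2 := mul_le_mul_of_nonneg_left (hsq (k + n) Dg) (by positivity : 0 ≤ α₁ / β₁ / 2)
  have e3 := mul_le_mul_of_nonneg_right hf4 hn1
  have e4 := mul_le_mul_of_nonneg_left (hg k hk x h1) hn2
  have e5 := hA (p.avg μ k (fun y => ‖s (k + m) y • Df y‖) x)
    (p.avg μ k (fun y => ‖s (k + n) y • Dg y‖) x)
  linarith

/-- The contribution of all cells that have not been stopped. -/
lemma sum_form_le (hs : p.IsStopping j s) (hμ : ∀ x, 0 < μ x) {B : ℝ} (hB : 1 ≤ B)
    (hdoub : ∀ k x, p.mass μ k x ≤ B * p.mass μ (k + 1) x) (ha : p.IsShiftKernel μ C₀ m n a)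
    (hC₀ : 0 ≤ C₀) (f g : Λ → 𝕜) {α₁ β₁ : ℝ} (hα : 0 < α₁) (hβ : 0 < β₁)
    (hf : ∀ k, j ≤ k → ∀ x, s k x = 1 → p.avg μ k (fun y => ‖f y‖) x ≤ 4 * α₁)
    (hg : ∀ k, j ≤ k → ∀ x, s k x = 1 → p.avg μ k (fun y => ‖g y‖) x ≤ 4 * β₁)
    (hf1 : ∑ x, μ x * (s j x * ‖f x‖) ≤ α₁ * ∑ x, μ x * s j x)
    (hg1 : ∑ x, μ x * (s j x * ‖g x‖) ≤ β₁ * ∑ x, μ x * s j x) (N : ℕ) :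
    ∑ k ∈ Ico j N, ∑ x, μ x * (s k x * (‖p.form μ a k f g x‖ / p.mass μ k x)) ≤
      16 * C₀ * B ^ 2 * (m + n + 1) * (α₁ * β₁ * ∑ x, μ x * s j x) := by
  set W := ∑ x, μ x * s j x with hW
  have hW0 : 0 ≤ W := sum_nonneg fun x _ => mul_nonneg (hμ x).le (hs.nonneg j x)
  have hpull : ∀ k ∈ Ico j N, ∀ u : Λ → ℝ, (∀ x, s k x * u x = u x) →
      ∑ x, μ x * (s k x * p.avg μ k u x) = ∑ x, μ x * u x := fun k hk u hu => by
    rw [p.sum_mul_avg hμ (hs.invariant k (mem_Ico.1 hk).1)]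
    simp only [hu]
  have hss : ∀ k l x, k ≤ l → s k x * s l x = s l x := fun k l x h => by
    rcases hs.zero_or_one l x with h0 | h1
    · simp [h0]
    · rw [hs.one_of_le h h1, one_mul]
  have hidem : ∀ k x, s k x * s k x = s k x := fun k x => hss k k x le_rfl
  have hmain : ∀ k ∈ Ico j N,
      ∑ x, μ x * (s k x * (‖p.form μ a k f g x‖ / p.mass μ k x)) ≤ C₀ * (
        β₁ / α₁ / 2 * ∑ x, μ x * (s (k + m) x *
          ‖p.avg μ (k + m + 1) f x - p.avg μ (k + m) f x‖ ^ 2) +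
        α₁ / β₁ / 2 * ∑ x, μ x * (s (k + n) x *
          ‖p.avg μ (k + n + 1) g x - p.avg μ (k + n) g x‖ ^ 2) +
        4 * β₁ * ∑ x, μ x * ((s k x - s (k + m) x) * ‖f x‖) +
        4 * α₁ * ∑ x, μ x * ((s k x - s (k + n) x) * ‖g x‖)) := by
    intro k hk
    rw [← hpull k hk (fun x => s (k + m) x * _) fun x => by rw [← mul_assoc, hss _ _ _ (by omega)],
      ← hpull k hk (fun x => s (k + n) x * _) fun x => by rw [← mul_assoc, hss _ _ _ (by omega)],
      ← hpull k hk (fun x => (s k x - s (k + m) x) * ‖f x‖) fun x => by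
        rw [← mul_assoc, mul_sub, hidem, hss _ _ _ (by omega)],
      ← hpull k hk (fun x => (s k x - s (k + n) x) * ‖g x‖) fun x => by
        rw [← mul_assoc, mul_sub, hidem, hss _ _ _ (by omega)]]
    simp only [mul_sum, ← sum_add_distrib]
    refine sum_le_sum fun x _ => ?_
    refine (mul_le_mul_of_nonneg_left
      (hs.form_le hμ ha hC₀ f g hα hβ hf hg (mem_Ico.1 hk).1 x) (hμ x).le).trans_eq ?_
    ring
  refine (sum_le_sum hmain).trans ?_
  rw [← mul_sum, sum_add_distrib, sum_add_distrib, sum_add_distrib, ← mul_sum, ← mul_sum,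
    ← mul_sum, ← mul_sum]
  have b1 := mul_le_mul_of_nonneg_left (hs.sum_sq_le hμ hB hdoub f hα.le hf N m)
    (by positivity : 0 ≤ β₁ / α₁ / 2)
  have b2 := mul_le_mul_of_nonneg_left (hs.sum_sq_le hμ hB hdoub g hβ.le hg N n)
    (by positivity : 0 ≤ α₁ / β₁ / 2)
  have b3 := mul_le_mul_of_nonneg_left ((hs.sum_shift_le hμ (fun x => ‖f x‖)
    (fun _ => norm_nonneg _) N m).trans (mul_le_mul_of_nonneg_left hf1 m.cast_nonneg))
    (by positivity : 0 ≤ 4 * β₁)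
  have b4 := mul_le_mul_of_nonneg_left ((hs.sum_shift_le hμ (fun x => ‖g x‖)
    (fun _ => norm_nonneg _) N n).trans (mul_le_mul_of_nonneg_left hg1 n.cast_nonneg))
    (by positivity : 0 ≤ 4 * α₁)
  have c1 : β₁ / α₁ / 2 * ((4 * B * α₁) ^ 2 * W) = 8 * B ^ 2 * (α₁ * β₁ * W) := by
    field_simp; ring
  have c2 : α₁ / β₁ / 2 * ((4 * B * β₁) ^ 2 * W) = 8 * B ^ 2 * (α₁ * β₁ * W) := by
    field_simp; ring
  rw [c1] at b1
  rw [c2] at b2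
  have hB2 : 1 ≤ B ^ 2 := one_le_pow₀ hB
  have hZ : 0 ≤ α₁ * β₁ * W := by positivity
  have hmn : (0 : ℝ) ≤ m + n := by positivity
  have d : 4 * (m + n) * (α₁ * β₁ * W) ≤ 16 * B ^ 2 * (m + n) * (α₁ * β₁ * W) :=
    mul_le_mul_of_nonneg_right (mul_le_mul_of_nonneg_right (by linarith) hmn) hZ
  calc _ ≤ C₀ * (8 * B ^ 2 * (α₁ * β₁ * W) + 8 * B ^ 2 * (α₁ * β₁ * W) +
        4 * β₁ * (m * (α₁ * W)) + 4 * α₁ * (n * (β₁ * W))) :=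
        mul_le_mul_of_nonneg_left (by linarith) hC₀
    _ ≤ C₀ * (16 * B ^ 2 * (m + n + 1) * (α₁ * β₁ * W)) :=
        mul_le_mul_of_nonneg_left (by linarith) hC₀
    _ = _ := by ring

/-- If a cell is stopped only when an average of `f` or `g` has grown fourfold, the stopped cells
fill at most half of the starting cell: the weak type bound for the maximal function. -/
lemma sum_stopped_le (hs : p.IsStopping j s) (hμ : ∀ x, 0 < μ x) (f g : Λ → ℝ)
    (hf0 : ∀ x, 0 ≤ f x) (hg0 : ∀ x, 0 ≤ g x) {α₁ β₁ : ℝ} (hα : 0 < α₁) (hβ : 0 < β₁)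
    (hgrow : ∀ k, j ≤ k → ∀ x, s k x = 1 → s (k + 1) x = 0 →
      4 * α₁ ≤ p.avg μ (k + 1) f x ∨ 4 * β₁ ≤ p.avg μ (k + 1) g x)
    (hf1 : ∑ x, μ x * (s j x * f x) ≤ α₁ * ∑ x, μ x * s j x)
    (hg1 : ∑ x, μ x * (s j x * g x) ≤ β₁ * ∑ x, μ x * s j x) {N : ℕ} (hN : j ≤ N) :
    ∑ x, μ x * (s j x - s N x) ≤ (∑ x, μ x * s j x) / 2 := by
  set v : Λ → ℝ := fun x => f x / (4 * α₁) + g x / (4 * β₁) with hv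
  have hv0 : ∀ x, 0 ≤ v x := fun x => by have := hf0 x; have := hg0 x; positivity
  -- On a cell stopped at generation `k + 1`, the average of `v` is at least `1`.
  have hstep : ∀ k ∈ Ico j N, ∑ x, μ x * (s k x - s (k + 1) x) ≤
      ∑ x, μ x * ((s k x - s (k + 1) x) * v x) := by
    intro k hk
    have hk' := (mem_Ico.1 hk).1
    have hinv : p.Invariant (k + 1) fun x => s k x - s (k + 1) x := fun x y h => by
      simp only [(hs.invariant k hk').mono k.le_succ x y h, hs.invariant (k + 1) (by omega) x y h]
    have hsplit : ∀ w : Λ → ℝ, ∀ γ : ℝ, ∑ x, μ x * ((s k x - s (k + 1) x) * (w x / γ)) =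
        ∑ x, μ x * ((s k x - s (k + 1) x) * (p.avg μ (k + 1) w x / γ)) := by
      intro w γ
      have := p.sum_mul_avg hμ hinv w
      simp only [← mul_div_assoc, ← sum_div, this]
    simp only [hv, mul_add, sum_add_distrib]
    rw [hsplit f, hsplit g, ← sum_add_distrib]
    refine sum_le_sum fun x _ => ?_
    have ef : 0 ≤ p.avg μ (k + 1) f x / (4 * α₁) :=
      div_nonneg (p.avg_nonneg hμ _ hf0 x) (by positivity)
    have eg : 0 ≤ p.avg μ (k + 1) g x / (4 * β₁) :=
      div_nonneg (p.avg_nonneg hμ _ hg0 x) (by positivity)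
    rw [← mul_add, ← mul_add]
    refine mul_le_mul_of_nonneg_left ?_ (hμ x).le
    rcases hs.zero_or_one (k + 1) x with h2 | h2
    · rcases hs.zero_or_one k x with h1 | h1
      · simp [h1, h2]
      · rw [h1, h2, sub_zero, one_mul]
        rcases hgrow k hk' x h1 h2 with h | h
        · linarith [(one_le_div (by positivity : 0 < 4 * α₁)).2 h]
        · linarith [(one_le_div (by positivity : 0 < 4 * β₁)).2 h]
    · simp [h2, hs.one_of_le k.le_succ h2]
  have htel : ∀ x, ∑ k ∈ Ico j N, (s k x - s (k + 1) x) = s j x - s N x := fun x => by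
    have := sum_Ico_sub (fun k => -s k x) hN
    simpa only [neg_sub_neg] using this
  calc ∑ x, μ x * (s j x - s N x)
      = ∑ k ∈ Ico j N, ∑ x, μ x * (s k x - s (k + 1) x) := by
        rw [sum_comm]
        exact sum_congr rfl fun x _ => by rw [← mul_sum, htel]
    _ ≤ ∑ k ∈ Ico j N, ∑ x, μ x * ((s k x - s (k + 1) x) * v x) := sum_le_sum hstep
    _ = ∑ x, μ x * ((s j x - s N x) * v x) := by
        rw [sum_comm]
        exact sum_congr rfl fun x _ => by rw [← mul_sum, ← sum_mul, htel]
    _ ≤ ∑ x, μ x * (s j x * v x) := sum_le_sum fun x _ => mul_le_mul_of_nonneg_left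
        (mul_le_mul_of_nonneg_right (by linarith [hs.nonneg N x]) (hv0 x)) (hμ x).le
    _ = (∑ x, μ x * (s j x * f x)) / (4 * α₁) + (∑ x, μ x * (s j x * g x)) / (4 * β₁) := by
        rw [sum_div, sum_div, ← sum_add_distrib]
        exact sum_congr rfl fun x _ => by simp only [hv]; ring
    _ ≤ (α₁ * ∑ x, μ x * s j x) / (4 * α₁) + (β₁ * ∑ x, μ x * s j x) / (4 * β₁) := by gcongr
    _ = _ := by field_simp; ring

end IsStopping

end PartitionTree

/-! ### Weighted estimates on the tree -/

namespace PartitionTree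

variable {Λ α : Type*} {p : PartitionTree Λ α} {𝕜 : Type*} [RCLike 𝕜]
variable {μ : Λ → ℝ} {C₀ : ℝ} {m n : ℕ} {a : ℕ → Λ → Λ → 𝕜}

variable (p) in
open Classical in
/-- The stopping time for the `j`-cell of `x₀`, as the indicator of the `k`-cells inside it that
have not been stopped: a subcell is stopped as soon as its average of `u` or of `v` exceeds four
times the average over the whole cell. -/
noncomputable def unstopped [Fintype Λ] (μ : Λ → ℝ) (u v : Λ → ℝ) (j : ℕ) (x₀ : Λ) (k : ℕ)
    (x : Λ) : ℝ :=
  if p.label j x = p.label j x₀ ∧ ∀ i, j ≤ i → i ≤ k →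
    p.avg μ i u x ≤ 4 * p.avg μ j u x₀ ∧ p.avg μ i v x ≤ 4 * p.avg μ j v x₀ then 1 else 0

variable [Fintype Λ]

variable (p) in
lemma unstopped_eq_one_iff {u v : Λ → ℝ} {j k : ℕ} {x₀ x : Λ} :
    p.unstopped μ u v j x₀ k x = 1 ↔ p.label j x = p.label j x₀ ∧ ∀ i, j ≤ i → i ≤ k →
      p.avg μ i u x ≤ 4 * p.avg μ j u x₀ ∧ p.avg μ i v x ≤ 4 * p.avg μ j v x₀ := by
  rw [unstopped]; split_ifs with h
  · simpa using h
  · simpa using h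

variable (p) in
lemma isStopping_unstopped (u v : Λ → ℝ) (j : ℕ) (x₀ : Λ) :
    p.IsStopping j (p.unstopped μ u v j x₀) where
  zero_or_one k x := by rw [unstopped]; split_ifs <;> simp
  anti x k l hkl := by
    simp only [unstopped]
    split_ifs with h1 h2 h2
    · exact le_rfl
    · exact absurd ⟨h1.1, fun i hi hik => h1.2 i hi (hik.trans hkl)⟩ h2
    · exact zero_le_one
    · exact le_rfl
  invariant k hk x y h := by
    have h1 : ∀ i ≤ k, ∀ w : Λ → ℝ, p.avg μ i w x = p.avg μ i w y := fun i hi w =>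
      p.avg_invariant μ i w x y (p.refine_le hi h)
    classical
    simp only [unstopped]
    refine if_congr (and_congr (by rw [p.refine_le hk h]) ?_) rfl rfl
    refine forall_congr' fun i => forall_congr' fun _ => forall_congr' fun hi => ?_
    rw [h1 i hi, h1 i hi]

lemma unstopped_start (hμ : ∀ x, 0 < μ x) {u v : Λ → ℝ} (hu : ∀ x, 0 ≤ u x) (hv : ∀ x, 0 ≤ v x)
    (j : ℕ) (x₀ x : Λ) : open Classical in
    p.unstopped μ u v j x₀ j x = if p.label j x = p.label j x₀ then 1 else 0 := by
  classical
  rw [unstopped]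
  refine if_congr (and_iff_left_of_imp fun h i hi hij => ?_) rfl rfl
  obtain rfl : i = j := le_antisymm hij hi
  rw [p.avg_invariant μ i u x x₀ h, p.avg_invariant μ i v x x₀ h]
  constructor
  · linarith [p.avg_nonneg hμ i hu x₀]
  · linarith [p.avg_nonneg hμ i hv x₀]

variable (p) in
/-- Estimates on each `k`-cell add up. -/
lemma sum_mul_le_of_forall_cell (hμ : ∀ x, 0 < μ x) {k : ℕ} {c u v : Λ → ℝ}
    (hc : p.Invariant k c) (hc0 : ∀ x, 0 ≤ c x)
    (h : ∀ x₀, ∑ x ∈ p.cell k x₀, μ x * u x ≤ ∑ x ∈ p.cell k x₀, μ x * v x) :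
    ∑ x, μ x * (c x * u x) ≤ ∑ x, μ x * (c x * v x) := by
  rw [← p.sum_mul_avg hμ hc u, ← p.sum_mul_avg hμ hc v]
  refine sum_le_sum fun x _ => mul_le_mul_of_nonneg_left (mul_le_mul_of_nonneg_left ?_ (hc0 x))
    (hμ x).le
  refine le_of_mul_le_mul_left ?_ (p.mass_pos hμ k x)
  rw [p.mass_mul_avg hμ, p.mass_mul_avg hμ]
  exact h x

variable (p) in
lemma avg_eq_zero_of_le (hμ : ∀ x, 0 < μ x) {u : Λ → ℝ} (hu : ∀ x, 0 ≤ u x) {j k : ℕ} (hjk : j ≤ k)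
    {x₀ x : Λ} (hx : p.label j x = p.label j x₀) (h : p.avg μ j u x₀ = 0) : p.avg μ k u x = 0 := by
  have h1 : ∑ y ∈ p.cell j x₀, μ y * u y = 0 := by rw [← p.mass_mul_avg hμ, h, mul_zero]
  have h2 := (sum_eq_zero_iff_of_nonneg fun y _ => mul_nonneg (hμ y).le (hu y)).1 h1
  have h3 : p.mass μ k x * p.avg μ k u x = 0 := by
    rw [p.mass_mul_avg hμ]
    refine sum_eq_zero fun y hy => h2 y ?_
    rw [← p.cell_congr hx]
    exact p.cell_anti hjk x hy
  exact (mul_eq_zero.1 h3).resolve_left (p.mass_pos hμ k x).ne'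

/-- The sum of the absolute values of the forms is controlled by any function that dominates all the
products of averages of `f` and `g`, in particular by a bilinear maximal function. -/
theorem IsShiftKernel.sum_form_le (ha : p.IsShiftKernel μ C₀ m n a) (hμ : ∀ x, 0 < μ x) {B : ℝ}
    (hB : 1 ≤ B) (hdoub : ∀ k x, p.mass μ k x ≤ B * p.mass μ (k + 1) x) (hC₀ : 0 ≤ C₀)
    (f g : Λ → 𝕜) {N : ℕ} {Φ : Λ → ℝ} (hΦ0 : ∀ x, 0 ≤ Φ x)
    (hΦ : ∀ k < N, ∀ x, p.avg μ k (fun y => ‖f y‖) x * p.avg μ k (fun y => ‖g y‖) x ≤ Φ x)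
    {j : ℕ} (hj : j ≤ N) (x₀ : Λ) :
    ∑ x ∈ p.cell j x₀, μ x * ∑ k ∈ Ico j N, ‖p.form μ a k f g x‖ / p.mass μ k x ≤
      ∑ x ∈ p.cell j x₀, μ x * (32 * C₀ * B ^ 2 * (m + n + 1) * Φ x) := by
  set C₁ := 32 * C₀ * B ^ 2 * (m + n + 1) with hC₁
  have hC₁0 : 0 ≤ C₁ := by positivity
  set b : ℕ → Λ → ℝ := fun k x => ‖p.form μ a k f g x‖ / p.mass μ k x with hb
  induction hd : N - j using Nat.strong_induction_on generalizing j x₀ with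
  | _ d ih =>
  rcases hj.eq_or_lt with rfl | hjN
  · simp only [Ico_self, sum_empty, mul_zero, sum_const_zero]
    exact sum_nonneg fun x _ => mul_nonneg (hμ x).le (mul_nonneg hC₁0 (hΦ0 x))
  have hf0 : ∀ x, 0 ≤ ‖f x‖ := fun _ => norm_nonneg _
  have hg0 : ∀ x, 0 ≤ ‖g x‖ := fun _ => norm_nonneg _
  set α₁ := p.avg μ j (fun y => ‖f y‖) x₀ with hα
  set β₁ := p.avg μ j (fun y => ‖g y‖) x₀ with hβ
  have hα0 : 0 ≤ α₁ := p.avg_nonneg hμ j hf0 x₀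
  have hβ0 : 0 ≤ β₁ := p.avg_nonneg hμ j hg0 x₀
  -- If `f` or `g` vanishes on the cell, so do all the forms; otherwise the thresholds are positive.
  by_cases hzero : α₁ = 0 ∨ β₁ = 0
  · refine sum_le_sum fun x hx => mul_le_mul_of_nonneg_left ?_ (hμ x).le
    refine le_trans (sum_nonpos fun k hk => ?_) (mul_nonneg hC₁0 (hΦ0 x))
    refine (ha.norm_form_div_le hμ k f g x).trans_eq ?_
    rcases hzero with h | h
    · rw [p.avg_eq_zero_of_le hμ hf0 (mem_Ico.1 hk).1 (p.mem_cell.1 hx) h, zero_mul, mul_zero]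
    · rw [p.avg_eq_zero_of_le hμ hg0 (mem_Ico.1 hk).1 (p.mem_cell.1 hx) h, mul_zero, mul_zero]
  rw [not_or] at hzero
  have hαp : 0 < α₁ := lt_of_le_of_ne hα0 (Ne.symm hzero.1)
  have hβp : 0 < β₁ := lt_of_le_of_ne hβ0 (Ne.symm hzero.2)
  set s := p.unstopped μ (fun y => ‖f y‖) (fun y => ‖g y‖) j x₀ with hsdef
  have hs : p.IsStopping j s := p.isStopping_unstopped _ _ j x₀
  have hcell : ∀ u : Λ → ℝ, ∑ x ∈ p.cell j x₀, μ x * u x = ∑ x, μ x * (s j x * u x) := by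
    classical
    intro u
    rw [sum_cell_eq]
    refine sum_congr rfl fun x _ => ?_
    rw [hsdef, unstopped_start hμ hf0 hg0]
    split_ifs <;> simp
  have hmass : ∑ x, μ x * s j x = p.mass μ j x₀ := by
    have := hcell fun _ => 1
    simp only [mul_one] at this
    rw [← this, mass]
  have hf1 : ∑ x, μ x * (s j x * ‖f x‖) ≤ α₁ * ∑ x, μ x * s j x := by
    rw [hmass, ← hcell, ← p.mass_mul_avg hμ, mul_comm]
  have hg1 : ∑ x, μ x * (s j x * ‖g x‖) ≤ β₁ * ∑ x, μ x * s j x := by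
    rw [hmass, ← hcell, ← p.mass_mul_avg hμ, mul_comm]
  have hactive := hs.sum_form_le hμ hB hdoub ha hC₀ f g hαp hβp
    (fun k hk x h => (((p.unstopped_eq_one_iff).1 h).2 k hk le_rfl).1)
    (fun k hk x h => (((p.unstopped_eq_one_iff).1 h).2 k hk le_rfl).2) hf1 hg1 N
  have hhalf := hs.sum_stopped_le hμ (fun x => ‖f x‖) (fun x => ‖g x‖) hf0 hg0 hαp hβp
    (fun k hk x h1 h0 => by
      by_contra! hcon
      have h1' := (p.unstopped_eq_one_iff).1 h1
      have : s (k + 1) x = 1 := (p.unstopped_eq_one_iff).2 ⟨h1'.1, fun i hi hik => by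
        rcases hik.eq_or_lt with rfl | hlt
        · exact ⟨hcon.1.le, hcon.2.le⟩
        · exact h1'.2 i hi (by omega)⟩
      rw [h0] at this
      exact zero_ne_one this) hf1 hg1 hj
  -- The part of the cell that is never stopped carries at least half of the mass.
  have hfirst : α₁ * β₁ * ∑ x, μ x * s j x ≤ 2 * ∑ x, μ x * (s N x * Φ x) := by
    have h1 : ∑ x, μ x * s j x ≤ 2 * ∑ x, μ x * s N x := by
      simp only [mul_sub, sum_sub_distrib] at hhalf
      linarith
    calc α₁ * β₁ * ∑ x, μ x * s j x ≤ α₁ * β₁ * (2 * ∑ x, μ x * s N x) :=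
          mul_le_mul_of_nonneg_left h1 (by positivity)
      _ = 2 * ∑ x, μ x * (s N x * (α₁ * β₁)) := by
          rw [mul_left_comm, mul_sum]
          congr 1
          exact sum_congr rfl fun x _ => by ring
      _ ≤ _ := by
          refine mul_le_mul_of_nonneg_left (sum_le_sum fun x _ => mul_le_mul_of_nonneg_left ?_
            (hμ x).le) zero_le_two
          rcases hs.zero_or_one N x with h | h
          · simp [h]
          · have hx := ((p.unstopped_eq_one_iff).1 h).1
            have := hΦ j hjN x
            rw [p.avg_invariant μ j _ x x₀ hx, p.avg_invariant μ j _ x x₀ hx] at this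
            rw [h, one_mul, one_mul]
            exact this
  -- Beyond the stopping time, the induction hypothesis applies to each stopped cell.
  have hrest : ∑ k ∈ Ico j N, ∑ x, μ x * ((s j x - s k x) * b k x) ≤
      ∑ x, μ x * ((s j x - s N x) * (C₁ * Φ x)) := by
    have hstep : ∀ t ∈ Ico j N, ∑ x, μ x * ((s t x - s (t + 1) x) * ∑ k ∈ Ico (t + 1) N, b k x) ≤
        ∑ x, μ x * ((s t x - s (t + 1) x) * (C₁ * Φ x)) := by
      intro t ht
      have ht' := mem_Ico.1 ht
      refine p.sum_mul_le_of_forall_cell hμ (k := t + 1) (fun x y h => ?_)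
        (fun x => hs.shift_nonneg t.le_succ x) fun x₁ => ?_
      · simp only [(hs.invariant t ht'.1).mono t.le_succ x y h,
          hs.invariant (t + 1) (by omega) x y h]
      · exact ih (N - (t + 1)) (by omega) (by omega) x₁ rfl
    calc ∑ k ∈ Ico j N, ∑ x, μ x * ((s j x - s k x) * b k x)
        = ∑ t ∈ Ico j N, ∑ x, μ x * ((s t x - s (t + 1) x) * ∑ k ∈ Ico (t + 1) N, b k x) := by
          rw [sum_comm, sum_comm (s := Ico j N)]
          refine sum_congr rfl fun x _ => ?_
          rw [← mul_sum, ← mul_sum, sum_sub_mul_eq (fun k => s k x)]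
      _ ≤ ∑ t ∈ Ico j N, ∑ x, μ x * ((s t x - s (t + 1) x) * (C₁ * Φ x)) := sum_le_sum hstep
      _ = _ := by
          rw [sum_comm]
          refine sum_congr rfl fun x _ => ?_
          have := sum_Ico_sub (fun k => -s k x) hj
          simp only [neg_sub_neg] at this
          rw [← mul_sum, ← sum_mul, this]
  calc ∑ x ∈ p.cell j x₀, μ x * ∑ k ∈ Ico j N, b k x
      = ∑ x, μ x * (s j x * ∑ k ∈ Ico j N, b k x) := hcell _
    _ = ∑ k ∈ Ico j N, ∑ x, μ x * (s k x * b k x) +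
        ∑ k ∈ Ico j N, ∑ x, μ x * ((s j x - s k x) * b k x) := by
        rw [← sum_add_distrib]
        simp only [mul_sum]
        rw [sum_comm]
        refine sum_congr rfl fun k _ => ?_
        rw [← sum_add_distrib]
        exact sum_congr rfl fun x _ => by ring
    _ ≤ 16 * C₀ * B ^ 2 * (m + n + 1) * (2 * ∑ x, μ x * (s N x * Φ x)) +
        ∑ x, μ x * ((s j x - s N x) * (C₁ * Φ x)) :=
        add_le_add (hactive.trans (mul_le_mul_of_nonneg_left hfirst (by positivity))) hrest
    _ = ∑ x, μ x * (s j x * (C₁ * Φ x)) := by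
        rw [← mul_assoc, mul_sum, ← sum_add_distrib]
        exact sum_congr rfl fun x _ => by rw [hC₁]; ring
    _ = ∑ x ∈ p.cell j x₀, μ x * (C₁ * Φ x) := (hcell _).symm

/-- The bilinear estimate behind the linear `A₂` bound: `w` and `σ` stand for the masses of a weight
and of its inverse. The averages of `f` and `g` are rewritten as averages with respect to `σ` and
`w`, at the cost of the `A₂` characteristic, and bounded by the maximal functions. -/
theorem IsShiftKernel.sum_form_le_weighted (ha : p.IsShiftKernel μ C₀ m n a) (hμ : ∀ x, 0 < μ x)
    {B : ℝ} (hB : 1 ≤ B) (hdoub : ∀ k x, p.mass μ k x ≤ B * p.mass μ (k + 1) x) (hC₀ : 0 ≤ C₀)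
    {w σ : Λ → ℝ} (hw : ∀ x, 0 < w x) (hσ : ∀ x, 0 < σ x) (hwσ : ∀ x, μ x ^ 2 ≤ σ x * w x)
    {A : ℝ} (hA0 : 0 ≤ A) {N : ℕ}
    (hA : ∀ k ≤ N, ∀ x, p.mass w k x * p.mass σ k x ≤ A * p.mass μ k x ^ 2) (f g : Λ → 𝕜) :
    ∑ x, μ x * ∑ k ∈ range N, ‖p.form μ a k f g x‖ / p.mass μ k x ≤
      128 * C₀ * B ^ 2 * (m + n + 1) * A * (√(∑ x, σ x * (‖f x‖ * μ x / σ x) ^ 2) *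
        √(∑ x, w x * (‖g x‖ * μ x / w x) ^ 2)) := by
  set φ : Λ → ℝ := fun x => ‖f x‖ * μ x / σ x with hφ
  set ψ : Λ → ℝ := fun x => ‖g x‖ * μ x / w x with hψ
  have hφ0 : ∀ x, 0 ≤ φ x := fun x => by have := hμ x; have := hσ x; positivity
  have hψ0 : ∀ x, 0 ≤ ψ x := fun x => by have := hμ x; have := hw x; positivity
  have hMφ : ∀ x, 0 ≤ p.maxAvg σ φ N x := fun x =>
    (p.avg_nonneg hσ 0 hφ0 x).trans (p.avg_le_maxAvg σ φ N.zero_le x)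
  have hMψ : ∀ x, 0 ≤ p.maxAvg w ψ N x := fun x =>
    (p.avg_nonneg hw 0 hψ0 x).trans (p.avg_le_maxAvg w ψ N.zero_le x)
  have hΦ : ∀ k < N, ∀ x, p.avg μ k (fun y => ‖f y‖) x * p.avg μ k (fun y => ‖g y‖) x ≤
      A * (p.maxAvg σ φ N x * p.maxAvg w ψ N x) := by
    intro k hk x
    have hm := p.mass_pos hμ k x
    have e1 : p.mass μ k x * p.avg μ k (fun y => ‖f y‖) x = p.mass σ k x * p.avg σ k φ x := by
      rw [p.mass_mul_avg hμ, p.mass_mul_avg hσ]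
      exact sum_congr rfl fun y _ => by have := (hσ y).ne'; simp only [hφ]; field_simp
    have e2 : p.mass μ k x * p.avg μ k (fun y => ‖g y‖) x = p.mass w k x * p.avg w k ψ x := by
      rw [p.mass_mul_avg hμ, p.mass_mul_avg hw]
      exact sum_congr rfl fun y _ => by have := (hw y).ne'; simp only [hψ]; field_simp
    refine le_of_mul_le_mul_left ?_ (pow_pos hm 2)
    calc p.mass μ k x ^ 2 * (p.avg μ k (fun y => ‖f y‖) x * p.avg μ k (fun y => ‖g y‖) x)
        = (p.mass μ k x * p.avg μ k (fun y => ‖f y‖) x) *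
          (p.mass μ k x * p.avg μ k (fun y => ‖g y‖) x) := by ring
      _ = (p.mass w k x * p.mass σ k x) * (p.avg σ k φ x * p.avg w k ψ x) := by
          rw [e1, e2]; ring
      _ ≤ (A * p.mass μ k x ^ 2) * (p.maxAvg σ φ N x * p.maxAvg w ψ N x) :=
          mul_le_mul (hA k hk.le x) (mul_le_mul (p.avg_le_maxAvg σ φ hk.le x)
            (p.avg_le_maxAvg w ψ hk.le x) (p.avg_nonneg hw k hψ0 x) (hMφ x))
            (mul_nonneg (p.avg_nonneg hσ k hφ0 x) (p.avg_nonneg hw k hψ0 x)) (by positivity)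
      _ = _ := by ring
  have h1 := p.sum_mul_le_of_forall_cell hμ (k := 0) (c := fun _ => 1) (fun _ _ _ => rfl)
    (fun _ => zero_le_one) fun x₀ => ha.sum_form_le hμ hB hdoub hC₀ f g (N := N)
    (fun x => mul_nonneg hA0 (mul_nonneg (hMφ x) (hMψ x))) hΦ N.zero_le x₀
  simp only [one_mul, Nat.Ico_zero_eq_range] at h1
  refine h1.trans ?_
  have h2 : ∑ x, μ x * (p.maxAvg σ φ N x * p.maxAvg w ψ N x) ≤
      4 * (√(∑ x, σ x * φ x ^ 2) * √(∑ x, w x * ψ x ^ 2)) := by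
    have hle : ∀ x, μ x ≤ √(σ x) * √(w x) := fun x => by
      rw [← Real.sqrt_mul (hσ x).le]
      exact Real.le_sqrt_of_sq_le (hwσ x)
    calc ∑ x, μ x * (p.maxAvg σ φ N x * p.maxAvg w ψ N x)
        ≤ ∑ x, (√(σ x) * p.maxAvg σ φ N x) * (√(w x) * p.maxAvg w ψ N x) :=
          sum_le_sum fun x _ => (mul_le_mul_of_nonneg_right (hle x)
            (mul_nonneg (hMφ x) (hMψ x))).trans_eq (by ring)
      _ ≤ √(∑ x, (√(σ x) * p.maxAvg σ φ N x) ^ 2) * √(∑ x, (√(w x) * p.maxAvg w ψ N x) ^ 2) :=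
          Real.sum_mul_le_sqrt_mul_sqrt _ _ _
      _ = √(∑ x, σ x * p.maxAvg σ φ N x ^ 2) * √(∑ x, w x * p.maxAvg w ψ N x ^ 2) := by
          simp only [mul_pow, Real.sq_sqrt (hσ _).le, Real.sq_sqrt (hw _).le]
      _ ≤ √(4 * ∑ x, σ x * φ x ^ 2) * √(4 * ∑ x, w x * ψ x ^ 2) :=
          mul_le_mul (Real.sqrt_le_sqrt (p.sum_maxAvg_sq_le hσ φ N))
            (Real.sqrt_le_sqrt (p.sum_maxAvg_sq_le hw ψ N)) (Real.sqrt_nonneg _)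
            (Real.sqrt_nonneg _)
      _ = _ := by
          rw [Real.sqrt_mul zero_le_four, Real.sqrt_mul zero_le_four,
            show √(4 : ℝ) = 2 by rw [show (4 : ℝ) = 2 ^ 2 by norm_num]; simp]
          ring
  calc ∑ x, μ x * (32 * C₀ * B ^ 2 * (m + n + 1) * (A * (p.maxAvg σ φ N x * p.maxAvg w ψ N x)))
      = 32 * C₀ * B ^ 2 * (m + n + 1) * A *
        ∑ x, μ x * (p.maxAvg σ φ N x * p.maxAvg w ψ N x) := by
        rw [mul_sum]; exact sum_congr rfl fun x _ => by ring
    _ ≤ _ := (mul_le_mul_of_nonneg_left h2 (by positivity)).trans_eq (by ring)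

variable (p) in
/-- The operator with the kernels `a k`. -/
noncomputable def shiftOp (μ : Λ → ℝ) (a : ℕ → Λ → Λ → 𝕜) (N : ℕ) (f : Λ → 𝕜) (x : Λ) : 𝕜 :=
  ∑ k ∈ range N, ∑ y ∈ p.cell k x, μ y • (a k x y * f y)

variable (p) in
lemma sum_shiftOp_mul (hμ : ∀ x, 0 < μ x) (N : ℕ) (f g : Λ → 𝕜) :
    ∑ x, μ x • (p.shiftOp μ a N f x * g x) =
      ∑ x, μ x • ∑ k ∈ range N, (p.mass μ k x)⁻¹ • p.form μ a k f g x := by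
  simp only [shiftOp, sum_mul, smul_sum]
  rw [sum_comm, sum_comm (t := range N)]
  refine sum_congr rfl fun k _ => ?_
  have h := p.sum_smul_mul_avg hμ (k := k) (c := fun _ => (1 : 𝕜)) (fun _ _ _ => rfl)
    fun x => ∑ y ∈ p.cell k x, μ y • (a k x y * f y * g x)
  simp only [one_mul] at h
  refine (sum_congr rfl fun x _ => ?_).trans (h.symm.trans (sum_congr rfl fun x _ => ?_))
  · rw [smul_sum]
    exact sum_congr rfl fun y _ => by rw [smul_mul_assoc]
  · rw [avg, form]
    congr 2
    refine sum_congr rfl fun z hz => ?_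
    rw [p.cell_congr (p.mem_cell.1 hz), smul_sum]
    exact sum_congr rfl fun y _ => by rw [mul_smul]

/-- The weighted norm inequality on the tree, from the bilinear estimate by duality. -/
theorem IsShiftKernel.sum_norm_shiftOp_sq_le (ha : p.IsShiftKernel μ C₀ m n a) (hμ : ∀ x, 0 < μ x)
    {B : ℝ} (hB : 1 ≤ B) (hdoub : ∀ k x, p.mass μ k x ≤ B * p.mass μ (k + 1) x) (hC₀ : 0 ≤ C₀)
    {w σ : Λ → ℝ} (hw : ∀ x, 0 < w x) (hσ : ∀ x, 0 < σ x) (hwσ : ∀ x, μ x ^ 2 ≤ σ x * w x)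
    {A : ℝ} (hA0 : 0 ≤ A) {N : ℕ}
    (hA : ∀ k ≤ N, ∀ x, p.mass w k x * p.mass σ k x ≤ A * p.mass μ k x ^ 2) (f : Λ → 𝕜) :
    ∑ x, w x * ‖p.shiftOp μ a N f x‖ ^ 2 ≤ (128 * C₀ * B ^ 2 * (m + n + 1) * A) ^ 2 *
      ∑ x, σ x * (‖f x‖ * μ x / σ x) ^ 2 := by
  set T := p.shiftOp μ a N f with hT
  -- The dual function, chosen so that pairing `T` with it gives `∑ w ‖T‖ ^ 2`.
  set g : Λ → 𝕜 := fun x => (w x / μ x) • (starRingEnd 𝕜) (T x) with hg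
  set S := ∑ x, w x * ‖T x‖ ^ 2 with hS
  have hS0 : 0 ≤ S := sum_nonneg fun x _ => mul_nonneg (hw x).le (sq_nonneg _)
  have h := ha.sum_form_le_weighted hμ hB hdoub hC₀ hw hσ hwσ hA0 hA f g
  have hgS : ∑ x, w x * (‖g x‖ * μ x / w x) ^ 2 = S := by
    refine sum_congr rfl fun x _ => ?_
    have h1 := (hμ x).ne'
    have h2 := (hw x).ne'
    simp only [hg]
    rw [norm_smul, RCLike.norm_conj, Real.norm_of_nonneg (div_pos (hw x) (hμ x)).le]
    field_simp
  have hSS : S ≤ ∑ x, μ x * ∑ k ∈ range N, ‖p.form μ a k f g x‖ / p.mass μ k x := by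
    have e : ∑ x, μ x • (T x * g x) = ((S : ℝ) : 𝕜) := by
      rw [hS, RCLike.ofReal_sum]
      refine sum_congr rfl fun x _ => ?_
      have h1 := (hμ x).ne'
      simp only [hg]
      rw [mul_smul_comm, RCLike.mul_conj, smul_smul, mul_div_cancel₀ _ h1,
        RCLike.real_smul_eq_coe_mul]
      push_cast; rfl
    have e2 : S = ‖∑ x, μ x • (T x * g x)‖ := by rw [e, RCLike.norm_ofReal, abs_of_nonneg hS0]
    rw [e2, hT, p.sum_shiftOp_mul hμ]
    refine (norm_sum_le _ _).trans (sum_le_sum fun x _ => ?_)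
    rw [norm_smul, Real.norm_of_nonneg (hμ x).le]
    refine mul_le_mul_of_nonneg_left ((norm_sum_le _ _).trans_eq (sum_congr rfl fun k _ => ?_))
      (hμ x).le
    rw [norm_smul, norm_inv, Real.norm_of_nonneg (p.mass_pos hμ k x).le, div_eq_inv_mul]
  rw [hgS] at h
  set R := ∑ x, σ x * (‖f x‖ * μ x / σ x) ^ 2 with hR
  have hR0 : 0 ≤ R := sum_nonneg fun x _ => mul_nonneg (hσ x).le (sq_nonneg _)
  set C := 128 * C₀ * B ^ 2 * (m + n + 1) * A with hC
  have hC0 : 0 ≤ C := by positivity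
  have h3 := hSS.trans h
  rcases hS0.eq_or_lt with h0 | hpos
  · rw [← h0]; positivity
  · have hsq : 0 < √S := Real.sqrt_pos.2 hpos
    have h4 : √S ≤ C * √R := by
      refine le_of_mul_le_mul_right ?_ hsq
      rw [Real.mul_self_sqrt hS0]; linarith
    calc S = √S ^ 2 := (Real.sq_sqrt hS0).symm
      _ ≤ (C * √R) ^ 2 := pow_le_pow_left₀ hsq.le h4 2
      _ = _ := by rw [mul_pow, Real.sq_sqrt hR0]

end PartitionTree

/-! ### The tree of a dyadic lattice -/

namespace DyadicLattice

variable {X : Type*} [MetricSpace X] [MeasurableSpace X] {μ : Measure X} {δ c C₁ : ℝ} {M : ℕ}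
  (G : DyadicLattice μ δ c C₁ M)

/-- The leaves of the lattice: the cubes of the finest generation. -/
abbrev Leaf : Type _ := ↥(G.E G.N)

/-- The cube of generation `min k N` that contains the leaf `ℓ`, written as a union over the
one-element set of such cubes. The cutoff at `N` makes the partitions constant from there on. -/
def ancestor (k : ℕ) (ℓ : G.Leaf) : Set X :=
  ⋃₀ {Q | Q ∈ G.E (min k G.N) ∧ (ℓ : Set X) ⊆ Q}

variable {G} (hδ : 0 < δ) (hc : 0 < c)
include hδ hc

lemma nonempty {k : ℕ} (hk : k ≤ G.N) {Q : Set X} (hQ : Q ∈ G.E k) : Q.Nonempty := by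
  obtain ⟨z, hz⟩ := G.ball_subset k hk Q hQ
  exact ⟨z, hz (mem_ball_self (by positivity))⟩

omit hδ hc in
lemma eq_of_mem {k : ℕ} (hk : k ≤ G.N) {Q Q' : Set X} (hQ : Q ∈ G.E k) (hQ' : Q' ∈ G.E k) {x : X}
    (h : x ∈ Q) (h' : x ∈ Q') : Q = Q' := by
  by_contra hne
  exact Set.disjoint_left.1 (G.disjoint k hk hQ hQ' hne) h h'

omit hδ hc in
lemma exists_superset {j k : ℕ} (hjk : j ≤ k) (hk : k ≤ G.N) {R : Set X} (hR : R ∈ G.E k) :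
    ∃ Q ∈ G.E j, R ⊆ Q := by
  induction k, hjk using Nat.le_induction generalizing R with
  | base => exact ⟨R, hR, subset_rfl⟩
  | succ k _ ih =>
    obtain ⟨Q, hQ, hRQ⟩ := G.nested k (by omega) R hR
    obtain ⟨P, hP, hQP⟩ := ih (by omega) hQ
    exact ⟨P, hP, hRQ.trans hQP⟩

lemma ancestor_eq {k : ℕ} (hk : k ≤ G.N) {Q : Set X} (hQ : Q ∈ G.E k) {ℓ : G.Leaf}
    (h : (ℓ : Set X) ⊆ Q) : G.ancestor k ℓ = Q := by
  rw [ancestor, min_eq_left hk]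
  obtain ⟨x, hx⟩ := nonempty hδ hc le_rfl ℓ.2
  have : {Q | Q ∈ G.E k ∧ (ℓ : Set X) ⊆ Q} = {Q} := by
    ext Q'
    simp only [Set.mem_ofPred_eq, Set.mem_singleton_iff]
    constructor
    · rintro ⟨h1, h2⟩
      exact eq_of_mem hk h1 hQ (h2 hx) (h hx)
    · rintro rfl
      exact ⟨hQ, h⟩
  rw [this, Set.sUnion_singleton]

lemma ancestor_mem {k : ℕ} (hk : k ≤ G.N) (ℓ : G.Leaf) : G.ancestor k ℓ ∈ G.E k := by
  obtain ⟨Q, hQ, h⟩ := exists_superset hk le_rfl ℓ.2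
  rwa [ancestor_eq hδ hc hk hQ h]

lemma leaf_subset_ancestor {k : ℕ} (hk : k ≤ G.N) (ℓ : G.Leaf) : (ℓ : Set X) ⊆ G.ancestor k ℓ := by
  obtain ⟨Q, hQ, h⟩ := exists_superset hk le_rfl ℓ.2
  rwa [ancestor_eq hδ hc hk hQ h]

lemma ancestor_subset {j k : ℕ} (hjk : j ≤ k) (hk : k ≤ G.N) (ℓ : G.Leaf) :
    G.ancestor k ℓ ⊆ G.ancestor j ℓ := by
  obtain ⟨Q, hQ, h⟩ := exists_superset hjk hk (ancestor_mem hδ hc hk ℓ)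
  rwa [ancestor_eq hδ hc (hjk.trans hk) hQ ((leaf_subset_ancestor hδ hc hk ℓ).trans h)]

omit hδ hc in
variable (G) in
lemma ancestor_of_le {k : ℕ} (hk : G.N ≤ k) (ℓ : G.Leaf) : G.ancestor k ℓ = G.ancestor G.N ℓ := by
  rw [ancestor, ancestor, min_eq_right hk, min_self]

variable (G) in
/-- The leaves of the lattice with the partitions given by its generations; from generation `N` on
the partition stays the one into leaves. -/
def tree : PartitionTree G.Leaf (Set X) where
  label := G.ancestor
  refine k ℓ ℓ' h := by
    rcases lt_or_ge k G.N with hk | hk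
    · have h1 := ancestor_subset hδ hc k.le_succ hk ℓ
      rw [Nat.succ_eq_add_one, h] at h1
      exact (ancestor_eq hδ hc hk.le (ancestor_mem hδ hc hk.le ℓ)
        ((leaf_subset_ancestor hδ hc hk ℓ').trans h1)).symm
    · rwa [G.ancestor_of_le hk, G.ancestor_of_le hk, ← G.ancestor_of_le (hk.trans k.le_succ),
        ← G.ancestor_of_le (hk.trans k.le_succ) ℓ']

/-- Up to a null set, a cube is the union of its leaves. -/
lemma ancestor_ae_eq {k : ℕ} (hk : k ≤ G.N) (ℓ : G.Leaf) :
    G.ancestor k ℓ =ᵐ[μ] ⋃ ℓ' ∈ (G.tree hδ hc).cell k ℓ, (ℓ' : Set X) := by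
  filter_upwards [G.cover G.N le_rfl] with x ⟨R, hR, hx⟩
  refine propext ⟨fun h => ?_, fun h => ?_⟩
  · refine Set.mem_iUnion₂.2 ⟨⟨R, hR⟩, PartitionTree.mem_cell _ |>.2 ?_, hx⟩
    exact eq_of_mem hk (ancestor_mem hδ hc hk _) (ancestor_mem hδ hc hk ℓ)
      (leaf_subset_ancestor hδ hc hk ⟨R, hR⟩ hx) h
  · obtain ⟨ℓ', h1, h2⟩ := Set.mem_iUnion₂.1 h
    have h3 : G.ancestor k ℓ' = G.ancestor k ℓ := PartitionTree.mem_cell _ |>.1 h1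
    have := leaf_subset_ancestor hδ hc hk ℓ' h2
    rwa [h3] at this

omit hδ hc in
variable (G) in
lemma univ_ae_eq : (Set.univ : Set X) =ᵐ[μ] ⋃ ℓ ∈ (univ : Finset G.Leaf), (ℓ : Set X) := by
  filter_upwards [G.cover G.N le_rfl] with x ⟨R, hR, hx⟩
  refine propext ⟨fun _ => ?_, fun _ => trivial⟩
  exact Set.mem_iUnion₂.2 ⟨⟨R, hR⟩, mem_univ _, hx⟩

omit hδ hc in
lemma leaf_pairwiseDisjoint (s : Set G.Leaf) :
    s.PairwiseDisjoint fun ℓ => (ℓ : Set X) := fun ℓ _ ℓ' _ h =>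
  G.disjoint G.N le_rfl ℓ.2 ℓ'.2 fun h' => h (Subtype.ext h')

omit hδ hc in
lemma measurableSet_leaf (ℓ : G.Leaf) : MeasurableSet (ℓ : Set X) :=
  G.measurable G.N le_rfl ℓ ℓ.2

lemma measure_ancestor {ν : Measure X} (hν : ν ≪ μ) {k : ℕ} (hk : k ≤ G.N) (ℓ : G.Leaf) :
    ν (G.ancestor k ℓ) = ∑ ℓ' ∈ (G.tree hδ hc).cell k ℓ, ν ℓ' := by
  rw [measure_congr (hν.ae_eq (ancestor_ae_eq hδ hc hk ℓ)),
    measure_biUnion_finset (leaf_pairwiseDisjoint _) fun ℓ' _ => measurableSet_leaf ℓ']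

lemma measureReal_ancestor {ν : Measure X} (hν : ν ≪ μ) (hfin : ∀ ℓ : G.Leaf, ν ℓ ≠ ∞) {k : ℕ}
    (hk : k ≤ G.N) (ℓ : G.Leaf) :
    ν.real (G.ancestor k ℓ) = (G.tree hδ hc).mass (fun ℓ' => ν.real ℓ') k ℓ := by
  rw [measureReal_def, measure_ancestor hδ hc hν hk, ENNReal.toReal_sum fun ℓ' _ => hfin ℓ']
  rfl

/-- Every cube of positive measure contains a leaf, hence is an ancestor. -/
lemma exists_ancestor_eq (hpos : ∀ (x : X) (r : ℝ), 0 < r → 0 < μ (ball x r)) {k : ℕ}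
    (hk : k ≤ G.N) {Q : Set X} (hQ : Q ∈ G.E k) : ∃ ℓ : G.Leaf, G.ancestor k ℓ = Q := by
  obtain ⟨z, hz⟩ := G.ball_subset k hk Q hQ
  have h1 : μ Q ≠ 0 := ((hpos z (c * δ ^ k) (by positivity)).trans_le (measure_mono hz)).ne'
  by_contra! hcon
  refine h1 (measure_mono_null ?_ (G.cover G.N le_rfl))
  rintro x hx ⟨R, hR, hxR⟩
  exact hcon ⟨R, hR⟩ (eq_of_mem hk (ancestor_mem hδ hc hk _) hQ
    (leaf_subset_ancestor hδ hc hk ⟨R, hR⟩ hxR) hx)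

lemma measure_pos (hpos : ∀ (x : X) (r : ℝ), 0 < r → 0 < μ (ball x r)) {k : ℕ}
    (hk : k ≤ G.N) {Q : Set X} (hQ : Q ∈ G.E k) : 0 < μ Q := by
  obtain ⟨z, hz⟩ := G.ball_subset k hk Q hQ
  exact (hpos z (c * δ ^ k) (by positivity)).trans_le (measure_mono hz)

omit hδ hc in
lemma measure_ball_two_pow_le {D : ℝ≥0} (hD : IsDoublingWith μ D) (x : X) {r : ℝ} (hr : 0 < r)
    (q : ℕ) : μ (ball x (2 ^ q * r)) ≤ (D : ℝ≥0∞) ^ q * μ (ball x r) := by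
  induction q with
  | zero => simp
  | succ q ih =>
    rw [pow_succ', mul_assoc, pow_succ', mul_assoc]
    exact ((hD x (2 ^ q * r) (by positivity)).2).trans (by gcongr)

/-- The doubling condition makes the lattice doubling: a cube is not much larger than its sons. -/
lemma measure_ancestor_le [CompactSpace X] {D : ℝ≥0} (hD : IsDoublingWith μ D) {q : ℕ}
    (hq : C₁ < 2 ^ q * (c * δ)) {k : ℕ} (hk : k < G.N) (ℓ : G.Leaf) :
    μ (G.ancestor k ℓ) ≤ (D : ℝ≥0∞) ^ q * μ (G.ancestor (k + 1) ℓ) := by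
  obtain ⟨z, hz⟩ := G.ball_subset (k + 1) hk _ (ancestor_mem hδ hc hk ℓ)
  have hr : 0 < c * δ ^ (k + 1) := by positivity
  have hzk := ancestor_subset hδ hc k.le_succ hk ℓ (hz (mem_ball_self hr))
  have hsub : G.ancestor k ℓ ⊆ ball z (2 ^ q * (c * δ ^ (k + 1))) := by
    intro x hx
    rw [mem_ball]
    calc dist x z ≤ diam (G.ancestor k ℓ) :=
          dist_le_diam_of_mem (isBounded_of_compactSpace) hx hzk
      _ ≤ C₁ * δ ^ k := G.diam_le k hk.le _ (ancestor_mem hδ hc hk.le ℓ)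
      _ < 2 ^ q * (c * δ) * δ ^ k := mul_lt_mul_of_pos_right hq (by positivity)
      _ = _ := by ring
  exact (measure_mono hsub).trans ((measure_ball_two_pow_le hD z hr q).trans (by gcongr))

lemma mass_le_mul_mass_succ [CompactSpace X] [IsFiniteMeasure μ] {D : ℝ≥0}
    (hD : IsDoublingWith μ D) {q : ℕ} (hq : C₁ < 2 ^ q * (c * δ)) (k : ℕ) (ℓ : G.Leaf) :
    (G.tree hδ hc).mass (fun ℓ' => μ.real ℓ') k ℓ ≤
      max 1 ((D : ℝ) ^ q) * (G.tree hδ hc).mass (fun ℓ' => μ.real ℓ') (k + 1) ℓ := by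
  rcases lt_or_ge k G.N with hk | hk
  · rw [← measureReal_ancestor hδ hc .rfl (fun _ => measure_ne_top _ _) hk.le,
      ← measureReal_ancestor hδ hc .rfl (fun _ => measure_ne_top _ _) hk]
    refine le_trans ?_ (mul_le_mul_of_nonneg_right (le_max_right _ _) measureReal_nonneg)
    have := ENNReal.toReal_mono (ENNReal.mul_ne_top (by simp) (measure_ne_top _ _))
      (measure_ancestor_le hδ hc hD hq hk ℓ)
    simpa [measureReal_def] using this
  · have h : (G.tree hδ hc).cell (k + 1) ℓ = (G.tree hδ hc).cell k ℓ := by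
      ext ℓ'
      simp only [PartitionTree.mem_cell, tree]
      rw [G.ancestor_of_le hk, G.ancestor_of_le hk, G.ancestor_of_le (hk.trans k.le_succ),
        G.ancestor_of_le (hk.trans k.le_succ)]
    rw [PartitionTree.mass, PartitionTree.mass, h]
    exact le_mul_of_one_le_left (sum_nonneg fun _ _ => measureReal_nonneg) (le_max_left _ _)

/-! ### Functions that are constant on the leaves -/

/-- A point of the leaf `ℓ`. -/
noncomputable def point (ℓ : G.Leaf) : X := (nonempty hδ hc le_rfl ℓ.2).some

lemma point_mem (ℓ : G.Leaf) : point hδ hc ℓ ∈ (ℓ : Set X) := (nonempty hδ hc le_rfl ℓ.2).some_mem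

lemma integral_eq_sum_leaf [IsFiniteMeasure μ] {u : X → ℝ}
    (hu : ∀ ℓ : G.Leaf, ∀ x ∈ (ℓ : Set X), ∀ y ∈ (ℓ : Set X), u x = u y) :
    ∫ x, u x ∂μ = ∑ ℓ : G.Leaf, μ.real ℓ * u (point hδ hc ℓ) := by
  have hc' : ∀ ℓ : G.Leaf, Set.EqOn u (fun _ => u (point hδ hc ℓ)) ℓ := fun ℓ x hx =>
    hu ℓ x hx _ (point_mem hδ hc ℓ)
  have hi : ∀ ℓ : G.Leaf, IntegrableOn u ℓ μ := fun ℓ =>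
    (integrableOn_congr_fun (hc' ℓ) (measurableSet_leaf ℓ)).2 (integrable_const _)
  rw [← setIntegral_univ, setIntegral_congr_set G.univ_ae_eq,
    integral_biUnion_finset _ (fun ℓ _ => measurableSet_leaf ℓ) (leaf_pairwiseDisjoint _)
      fun ℓ _ => hi ℓ]
  refine sum_congr rfl fun ℓ _ => ?_
  rw [setIntegral_congr_fun (measurableSet_leaf ℓ) (hc' ℓ), setIntegral_const, smul_eq_mul]

end DyadicLattice

/-! ### Haar functions on the tree -/

namespace HaarSystem

open DyadicLattice

variable {X : Type*} [MetricSpace X] [MeasurableSpace X] {μ : Measure X} {δ c C₁ : ℝ} {M : ℕ}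
  {G : DyadicLattice μ δ c C₁ M} {K : ℝ} (H : HaarSystem G K)

lemma eq_of_mem_succ {k : ℕ} (hk : k < G.N) {Q : Set X} (hQ : Q ∈ G.E k) {j : ℕ}
    (hj : j < H.num k Q) {R : Set X} (hR : R ∈ G.E (k + 1)) {x y : X} (hx : x ∈ R) (hy : y ∈ R) :
    H.h k Q j x = H.h k Q j y := by
  classical
  obtain ⟨P, hP, hRP⟩ := G.nested k hk R hR
  by_cases hPQ : P = Q
  · subst hPQ
    exact H.const_on_sons k hk P hQ j hj R (mem_filter.2 ⟨hR, hRP⟩) x hx y hy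
  · have hnot : ∀ z ∈ R, z ∉ Q := fun z hz hzQ =>
      hPQ (DyadicLattice.eq_of_mem hk.le hP hQ (hRP hz) hzQ)
    rw [H.support k hk Q hQ j hj x (hnot x hx), H.support k hk Q hQ j hj y (hnot y hy)]

variable (hδ : 0 < δ) (hc : 0 < c)
include hδ hc

lemma eq_of_mem_leaf {k : ℕ} (hk : k < G.N) {Q : Set X} (hQ : Q ∈ G.E k) {j : ℕ}
    (hj : j < H.num k Q) (ℓ : G.Leaf) {x y : X} (hx : x ∈ (ℓ : Set X)) (hy : y ∈ (ℓ : Set X)) :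
    H.h k Q j x = H.h k Q j y :=
  H.eq_of_mem_succ hk hQ hj (ancestor_mem hδ hc hk ℓ) (leaf_subset_ancestor hδ hc hk ℓ hx)
    (leaf_subset_ancestor hδ hc hk ℓ hy)

lemma eq_zero_of_ancestor_ne {k : ℕ} (hk : k < G.N) {Q : Set X} (hQ : Q ∈ G.E k) {j : ℕ}
    (hj : j < H.num k Q) {ℓ : G.Leaf} (h : G.ancestor k ℓ ≠ Q) {x : X} (hx : x ∈ (ℓ : Set X)) :
    H.h k Q j x = 0 :=
  H.support k hk Q hQ j hj x fun hxQ => h (DyadicLattice.eq_of_mem hk.le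
    (ancestor_mem hδ hc hk.le ℓ) hQ (leaf_subset_ancestor hδ hc hk.le ℓ hx) hxQ)

lemma sum_cell_eq_zero [IsFiniteMeasure μ] {k : ℕ} (hk : k < G.N) {Q : Set X} (hQ : Q ∈ G.E k)
    {j : ℕ} (hj : j < H.num k Q) (ℓ₀ : G.Leaf) :
    ∑ ℓ ∈ (G.tree hδ hc).cell k ℓ₀, μ.real ℓ * H.h k Q j (point hδ hc ℓ) = 0 := by
  by_cases h : G.ancestor k ℓ₀ = Q
  · rw [← H.integral_eq_zero k hk Q hQ j hj, integral_eq_sum_leaf hδ hc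
      fun ℓ x hx y hy => H.eq_of_mem_leaf hδ hc hk hQ hj ℓ hx hy]
    refine sum_subset (subset_univ _) fun ℓ _ hℓ => ?_
    rw [H.eq_zero_of_ancestor_ne hδ hc hk hQ hj _ (point_mem hδ hc ℓ), mul_zero]
    intro h'
    exact hℓ (PartitionTree.mem_cell _ |>.2 (h'.trans h.symm))
  · refine sum_eq_zero fun ℓ hℓ => ?_
    rw [H.eq_zero_of_ancestor_ne hδ hc hk hQ hj _ (point_mem hδ hc ℓ), mul_zero]
    rw [show G.ancestor k ℓ = G.ancestor k ℓ₀ from PartitionTree.mem_cell _ |>.1 hℓ]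
    exact h

lemma abs_le_of_mem_leaf (hpos : ∀ (x : X) (r : ℝ), 0 < r → 0 < μ (ball x r)) {k : ℕ}
    (hk : k < G.N) {Q : Set X} (hQ : Q ∈ G.E k) {j : ℕ} (hj : j < H.num k Q) {ℓ : G.Leaf} {x : X}
    (hx : x ∈ (ℓ : Set X)) : |H.h k Q j x| ≤ K / √(μ.real Q) := by
  by_contra hcon
  refine (measure_pos hδ hc hpos le_rfl ℓ.2).ne' (measure_mono_null ?_ (H.bound k hk Q hQ j hj))
  intro y hy
  rw [Set.mem_compl_iff, Set.mem_ofPred_eq, H.eq_of_mem_leaf hδ hc hk hQ hj ℓ hy hx]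
  exact hcon

/-- A cube carries at most `M` Haar functions: being orthonormal, they are linearly independent in
the space of functions on its sons. -/
lemma num_le [IsFiniteMeasure μ] {k : ℕ} (hk : k < G.N) {Q : Set X} (hQ : Q ∈ G.E k) :
    H.num k Q ≤ M := by
  classical
  set S := G.descendants k Q 1 with hS
  have hmem : ∀ R ∈ S, R ∈ G.E (k + 1) := fun R hR => (mem_filter.1 hR).1
  have hcard : S.card ≤ M := by
    refine le_trans (le_of_eq ?_) (G.card_sons_le k hk Q hQ)
    rw [← Set.ncard_coe_finset]
    congr 1
    ext R
    simp [hS, descendants]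
  let v : Fin (H.num k Q) → (S → ℝ) := fun i R =>
    H.h k Q i (DyadicLattice.nonempty hδ hc hk (hmem R R.2)).some
  have hv : LinearIndependent ℝ v := by
    rw [Fintype.linearIndependent_iff]
    intro g hg j
    have hpt : ∀ ℓ : G.Leaf, ∑ i, g i * H.h k Q i (point hδ hc ℓ) = 0 := by
      intro ℓ
      by_cases hℓ : G.ancestor k ℓ = Q
      · have hR : G.ancestor (k + 1) ℓ ∈ S := mem_filter.2
          ⟨ancestor_mem hδ hc hk ℓ, (ancestor_subset hδ hc k.le_succ hk ℓ).trans hℓ.le⟩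
        have := congrFun hg ⟨_, hR⟩
        simp only [Finset.sum_apply, Pi.smul_apply, smul_eq_mul, Pi.zero_apply] at this
        rw [← this]
        refine sum_congr rfl fun i _ => ?_
        rw [H.eq_of_mem_succ hk hQ i.2 (hmem _ hR)
          (leaf_subset_ancestor hδ hc hk ℓ (point_mem hδ hc ℓ)) (Set.Nonempty.some_mem _)]
      · exact sum_eq_zero fun i _ => by
          rw [H.eq_zero_of_ancestor_ne hδ hc hk hQ i.2 hℓ (point_mem hδ hc ℓ), mul_zero]
    have horth : ∀ i : Fin (H.num k Q), ∑ ℓ : G.Leaf, μ.real ℓ *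
        (H.h k Q i (point hδ hc ℓ) * H.h k Q j (point hδ hc ℓ)) = if i = j then 1 else 0 := by
      intro i
      have h1 := H.orthonormal k hk Q hQ i i.2 j j.2
      rw [integral_eq_sum_leaf hδ hc fun ℓ x hx y hy => by
        rw [H.eq_of_mem_leaf hδ hc hk hQ i.2 ℓ hx hy,
          H.eq_of_mem_leaf hδ hc hk hQ j.2 ℓ hx hy]] at h1
      rw [h1]
      simp [Fin.ext_iff]
    calc g j = ∑ i, g i * if i = j then 1 else 0 := by simp
      _ = ∑ ℓ : G.Leaf, μ.real ℓ * H.h k Q j (point hδ hc ℓ) *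
            ∑ i, g i * H.h k Q i (point hδ hc ℓ) := by
          simp_rw [← horth, mul_sum]
          rw [sum_comm]
          exact sum_congr rfl fun ℓ _ => sum_congr rfl fun i _ => by ring
      _ = 0 := by simp [hpt]
  have := hv.fintype_card_le_finrank
  simp only [Fintype.card_fin, Module.finrank_fintype_fun_eq_card, Fintype.card_coe] at this
  exact this.trans hcard

end HaarSystem

/-! ### The kernels of a dyadic shift -/

namespace DyadicShift

open DyadicLattice

variable {X : Type*} [MetricSpace X] [MeasurableSpace X] {μ : Measure X} {δ c C₁ : ℝ} {M : ℕ}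
  {G : DyadicLattice μ δ c C₁ M} {K : ℝ} {H : HaarSystem G K} {𝕜 : Type*} [RCLike 𝕜] {m n : ℕ}
  (S : DyadicShift 𝕜 H m n)

lemma kernel_congr_right {k : ℕ} (hm : k + m < G.N) {L R : Set X} (hR : R ∈ G.E (k + m + 1))
    (x : X) {y y' : X} (hy : y ∈ R) (hy' : y' ∈ R) : S.kernel k L x y = S.kernel k L x y' := by
  classical
  refine sum_congr rfl fun I hI => sum_congr rfl fun J _ => sum_congr rfl fun i hi =>
    sum_congr rfl fun j _ => ?_
  rw [H.eq_of_mem_succ hm (mem_filter.1 hI).1 (mem_range.1 hi) hR hy hy']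

lemma kernel_congr_left {k : ℕ} (hn : k + n < G.N) {L R : Set X} (hR : R ∈ G.E (k + n + 1))
    (y : X) {x x' : X} (hx : x ∈ R) (hx' : x' ∈ R) : S.kernel k L x y = S.kernel k L x' y := by
  classical
  refine sum_congr rfl fun I _ => sum_congr rfl fun J hJ => sum_congr rfl fun i _ =>
    sum_congr rfl fun j hj => ?_
  rw [H.eq_of_mem_succ hn (mem_filter.1 hJ).1 (mem_range.1 hj) hR hx hx']

lemma kernel_eq_zero {k : ℕ} (hn : k + n < G.N) {L : Set X} {x : X} (hx : x ∉ L) (y : X) :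
    S.kernel k L x y = 0 := by
  classical
  refine sum_eq_zero fun I _ => sum_eq_zero fun J hJ => sum_eq_zero fun i _ =>
    sum_eq_zero fun j hj => ?_
  rw [H.support (k + n) hn J (mem_filter.1 hJ).1 j (mem_range.1 hj) x
    fun h => hx ((mem_filter.1 hJ).2 h)]
  simp

variable (hδ : 0 < δ) (hc : 0 < c)
include hδ hc

/-- The kernels of the shift on the tree of the lattice, extended by zero to the generations that do
not occur in the shift. -/
noncomputable def treeKernel (k : ℕ) (ℓ' ℓ : G.Leaf) : 𝕜 :=
  if k + m < G.N ∧ k + n < G.N then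
    S.kernel k (G.ancestor k ℓ') (point hδ hc ℓ') (point hδ hc ℓ) else 0

/-- Only one pair `I`, `J` contributes to the kernel at a given point. -/
lemma norm_kernel_le [IsFiniteMeasure μ] (hpos : ∀ (x : X) (r : ℝ), 0 < r → 0 < μ (ball x r))
    {k : ℕ} (hm : k + m < G.N) (hn : k + n < G.N) {ℓ' ℓ : G.Leaf}
    (h : G.ancestor k ℓ = G.ancestor k ℓ') :
    ‖S.kernel k (G.ancestor k ℓ') (point hδ hc ℓ') (point hδ hc ℓ)‖ ≤
      (M : ℝ) ^ 2 * K ^ 2 / μ.real (G.ancestor k ℓ') := by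
  classical
  have hk : k < G.N := by omega
  set L := G.ancestor k ℓ' with hL
  have hLE : L ∈ G.E k := ancestor_mem hδ hc hk.le ℓ'
  set I₀ := G.ancestor (k + m) ℓ with hI₀
  set J₀ := G.ancestor (k + n) ℓ' with hJ₀
  have hI₀E : I₀ ∈ G.E (k + m) := ancestor_mem hδ hc hm.le ℓ
  have hJ₀E : J₀ ∈ G.E (k + n) := ancestor_mem hδ hc hn.le ℓ'
  have hI₀L : I₀ ∈ G.descendants k L m := mem_filter.2
    ⟨hI₀E, (ancestor_subset hδ hc (Nat.le_add_right k m) hm.le ℓ).trans h.le⟩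
  have hJ₀L : J₀ ∈ G.descendants k L n := mem_filter.2
    ⟨hJ₀E, ancestor_subset hδ hc (Nat.le_add_right k n) hn.le ℓ'⟩
  have hreal : ∀ {l : ℕ} {Q : Set X}, l ≤ G.N → Q ∈ G.E l → 0 < μ.real Q := fun hl hQ =>
    ENNReal.toReal_pos (measure_pos hδ hc hpos hl hQ).ne' (measure_ne_top _ _)
  have hIpos := hreal hm.le hI₀E
  have hJpos := hreal hn.le hJ₀E
  have hLpos := hreal hk.le hLE
  -- A Haar function of any other cube vanishes on the leaf.
  have hker : S.kernel k L (point hδ hc ℓ') (point hδ hc ℓ) =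
      ∑ i ∈ range (H.num (k + m) I₀), ∑ j ∈ range (H.num (k + n) J₀), S.coeff k L I₀ J₀ i j *
        ((H.h (k + n) J₀ j (point hδ hc ℓ') * H.h (k + m) I₀ i (point hδ hc ℓ) : ℝ) : 𝕜) := by
    rw [kernel, sum_eq_single_of_mem I₀ hI₀L fun I hI hne => ?_,
      sum_eq_single_of_mem J₀ hJ₀L fun J hJ hne => ?_]
    · refine sum_eq_zero fun i _ => sum_eq_zero fun j hj => ?_
      rw [H.eq_zero_of_ancestor_ne hδ hc hn (mem_filter.1 hJ).1 (mem_range.1 hj) hne.symm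
        (point_mem hδ hc ℓ')]
      simp
    · refine sum_eq_zero fun J _ => sum_eq_zero fun i hi => sum_eq_zero fun j _ => ?_
      rw [H.eq_zero_of_ancestor_ne hδ hc hm (mem_filter.1 hI).1 (mem_range.1 hi) hne.symm
        (point_mem hδ hc ℓ)]
      simp
  rw [hker]
  have hterm : ∀ i ∈ range (H.num (k + m) I₀), ∀ j ∈ range (H.num (k + n) J₀),
      ‖S.coeff k L I₀ J₀ i j * ((H.h (k + n) J₀ j (point hδ hc ℓ') *
        H.h (k + m) I₀ i (point hδ hc ℓ) : ℝ) : 𝕜)‖ ≤ K ^ 2 / μ.real L := by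
    intro i hi j hj
    rw [mem_range] at hi hj
    have b1 := S.bound k hm hn L hLE I₀ hI₀L J₀ hJ₀L i hi j hj
    have b2 := H.abs_le_of_mem_leaf hδ hc hpos hn hJ₀E hj (point_mem hδ hc ℓ')
    have b3 := H.abs_le_of_mem_leaf hδ hc hpos hm hI₀E hi (point_mem hδ hc ℓ)
    rw [norm_mul, RCLike.norm_ofReal, abs_mul]
    have s1 := Real.sqrt_pos.2 hIpos
    have s2 := Real.sqrt_pos.2 hJpos
    calc _ ≤ √(μ.real I₀) * √(μ.real J₀) / μ.real L *
          (K / √(μ.real J₀) * (K / √(μ.real I₀))) :=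
          mul_le_mul b1 (mul_le_mul b2 b3 (abs_nonneg _) ((abs_nonneg _).trans b2))
            (by positivity) (by positivity)
      _ = _ := by field_simp
  have hM1 : (H.num (k + m) I₀ : ℝ) ≤ M := by exact_mod_cast H.num_le hδ hc hm hI₀E
  have hM2 : (H.num (k + n) J₀ : ℝ) ≤ M := by exact_mod_cast H.num_le hδ hc hn hJ₀E
  calc _ ≤ ∑ i ∈ range (H.num (k + m) I₀), ∑ j ∈ range (H.num (k + n) J₀), K ^ 2 / μ.real L :=
        (norm_sum_le _ _).trans (sum_le_sum fun i hi => (norm_sum_le _ _).trans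
          (sum_le_sum fun j hj => hterm i hi j hj))
    _ = (H.num (k + m) I₀ : ℝ) * H.num (k + n) J₀ * (K ^ 2 / μ.real L) := by
        simp [mul_assoc]
    _ ≤ M * M * (K ^ 2 / μ.real L) := by gcongr
    _ = _ := by ring

lemma isShiftKernel_treeKernel [IsFiniteMeasure μ]
    (hpos : ∀ (x : X) (r : ℝ), 0 < r → 0 < μ (ball x r)) :
    (G.tree hδ hc).IsShiftKernel (fun ℓ => μ.real ℓ) ((M : ℝ) ^ 2 * K ^ 2) m n
      (S.treeKernel hδ hc) where
  bound k ℓ' ℓ h := by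
    rw [treeKernel]
    split_ifs with hk
    · rw [← measureReal_ancestor hδ hc .rfl (fun _ => measure_ne_top _ _) (by omega)]
      exact S.norm_kernel_le hδ hc hpos hk.1 hk.2 h
    · rw [norm_zero]
      exact div_nonneg (by positivity) (sum_nonneg fun _ _ => measureReal_nonneg)
  invariant_right k ℓ' ℓ₁ ℓ₂ h := by
    simp only [treeKernel]
    split_ifs with hk
    · have h1 : G.ancestor (k + m + 1) ℓ₁ = G.ancestor (k + m + 1) ℓ₂ := h
      have h2 := leaf_subset_ancestor hδ hc (k := k + m + 1) (by omega) ℓ₁ (point_mem hδ hc ℓ₁)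
      rw [h1] at h2
      exact S.kernel_congr_right hk.1 (ancestor_mem hδ hc (by omega) ℓ₂) _ h2
        (leaf_subset_ancestor hδ hc (by omega) ℓ₂ (point_mem hδ hc ℓ₂))
    · rfl
  invariant_left k ℓ ℓ₁ ℓ₂ h := by
    simp only [treeKernel]
    have h0 : G.ancestor k ℓ₁ = G.ancestor k ℓ₂ := (G.tree hδ hc).refine_le (by omega) h
    split_ifs with hk
    · have h1 : G.ancestor (k + n + 1) ℓ₁ = G.ancestor (k + n + 1) ℓ₂ := h
      have h2 := leaf_subset_ancestor hδ hc (k := k + n + 1) (by omega) ℓ₁ (point_mem hδ hc ℓ₁)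
      rw [h1] at h2
      rw [h0]
      exact S.kernel_congr_left hk.2 (ancestor_mem hδ hc (by omega) ℓ₂) _ h2
        (leaf_subset_ancestor hδ hc (by omega) ℓ₂ (point_mem hδ hc ℓ₂))
    · rfl
  cancel_right k ℓ' ℓ₀ := by
    classical
    by_cases hk : k + m < G.N ∧ k + n < G.N
    · simp only [treeKernel, if_pos hk, kernel, smul_sum]
      rw [sum_comm]
      refine sum_eq_zero fun I hI => ?_
      rw [sum_comm]
      refine sum_eq_zero fun J _ => ?_
      rw [sum_comm]
      refine sum_eq_zero fun i hi => ?_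
      rw [sum_comm]
      refine sum_eq_zero fun j _ => ?_
      have h0 := congrArg (fun r : ℝ => (r : 𝕜)) (H.sum_cell_eq_zero hδ hc hk.1
        (mem_filter.1 hI).1 (mem_range.1 hi) ℓ₀)
      simp only [RCLike.ofReal_sum, RCLike.ofReal_mul, RCLike.ofReal_zero] at h0
      rw [← mul_zero (S.coeff k (G.ancestor k ℓ') I J i j *
        (H.h (k + n) J j (point hδ hc ℓ') : 𝕜)), ← h0, mul_sum]
      refine sum_congr rfl fun ℓ _ => ?_
      rw [RCLike.real_smul_eq_coe_mul]
      push_cast; ring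
    · simp only [treeKernel, if_neg hk, smul_zero, sum_const_zero]
  cancel_left k ℓ ℓ₀ := by
    classical
    by_cases hk : k + m < G.N ∧ k + n < G.N
    · have h1 : ∀ ℓ' ∈ (G.tree hδ hc).cell (k + n) ℓ₀, μ.real ℓ' • S.treeKernel hδ hc k ℓ' ℓ =
          μ.real ℓ' • S.kernel k (G.ancestor k ℓ₀) (point hδ hc ℓ') (point hδ hc ℓ) := by
        intro ℓ' hℓ'
        rw [treeKernel, if_pos hk, show G.ancestor k ℓ' = G.ancestor k ℓ₀ from
          (G.tree hδ hc).refine_le (Nat.le_add_right k n) (PartitionTree.mem_cell _ |>.1 hℓ')]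
      rw [sum_congr rfl h1]
      simp only [kernel, smul_sum]
      rw [sum_comm]
      refine sum_eq_zero fun I _ => ?_
      rw [sum_comm]
      refine sum_eq_zero fun J hJ => ?_
      rw [sum_comm]
      refine sum_eq_zero fun i _ => ?_
      rw [sum_comm]
      refine sum_eq_zero fun j hj => ?_
      have h0 := congrArg (fun r : ℝ => (r : 𝕜)) (H.sum_cell_eq_zero hδ hc hk.2
        (mem_filter.1 hJ).1 (mem_range.1 hj) ℓ₀)
      simp only [RCLike.ofReal_sum, RCLike.ofReal_mul, RCLike.ofReal_zero] at h0
      rw [← mul_zero (S.coeff k (G.ancestor k ℓ₀) I J i j *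
        (H.h (k + m) I i (point hδ hc ℓ) : 𝕜)), ← h0, mul_sum]
      refine sum_congr rfl fun ℓ' _ => ?_
      rw [RCLike.real_smul_eq_coe_mul]
      push_cast; ring
    · simp only [treeKernel, if_neg hk, smul_zero, sum_const_zero]

lemma kernel_congr_leaf {k : ℕ} (hm : k + m < G.N) (L : Set X) (x : X)
    (ℓ : G.Leaf) : Set.EqOn (S.kernel k L x) (fun _ => S.kernel k L x (point hδ hc ℓ)) ℓ :=
  fun _ hy => S.kernel_congr_right hm (ancestor_mem hδ hc hm ℓ) x
    (leaf_subset_ancestor hδ hc hm ℓ hy) (leaf_subset_ancestor hδ hc hm ℓ (point_mem hδ hc ℓ))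

lemma integrableOn_kernel_mul_leaf {k : ℕ} (hm : k + m < G.N) (L : Set X) (x : X) {f : X → 𝕜}
    {ℓ : G.Leaf} (hf : IntegrableOn f ℓ μ) :
    IntegrableOn (fun y => S.kernel k L x y * f y) ℓ μ :=
  (integrableOn_congr_fun (g := fun y => S.kernel k L x (point hδ hc ℓ) * f y) (fun y hy => by
    simp only [S.kernel_congr_leaf hδ hc hm L x ℓ hy]) (measurableSet_leaf ℓ)).2 (hf.const_mul _)

lemma integrableOn_kernel_mul (hpos : ∀ (x : X) (r : ℝ), 0 < r → 0 < μ (ball x r)) {k : ℕ}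
    (hm : k + m < G.N) {L : Set X} (hL : L ∈ G.E k) (x : X) {f : X → 𝕜}
    (hf : ∀ ℓ : G.Leaf, IntegrableOn f ℓ μ) :
    IntegrableOn (fun y => S.kernel k L x y * f y) L μ := by
  obtain ⟨ℓ₀, rfl⟩ := exists_ancestor_eq hδ hc hpos (by omega) hL
  rw [IntegrableOn, Measure.restrict_congr_set (ancestor_ae_eq hδ hc (by omega) ℓ₀)]
  exact (integrableOn_finset_iUnion).2 fun ℓ _ =>
    S.integrableOn_kernel_mul_leaf hδ hc hm _ x (hf ℓ)

/-- The shift is constant on the leaves, and acts there as an operator on the tree. -/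
lemma toFun_eq_shiftOp [IsFiniteMeasure μ] (hpos : ∀ (x : X) (r : ℝ), 0 < r → 0 < μ (ball x r))
    {f : X → 𝕜} (hf : ∀ ℓ : G.Leaf, IntegrableOn f ℓ μ) {ℓ' : G.Leaf} {x : X}
    (hx : x ∈ (ℓ' : Set X)) :
    S.toFun f x = (G.tree hδ hc).shiftOp (fun ℓ => μ.real ℓ) (S.treeKernel hδ hc) G.N
      (fun ℓ => (μ.real ℓ)⁻¹ • ∫ y in (ℓ : Set X), f y ∂μ) ℓ' := by
  rw [toFun, PartitionTree.shiftOp, sum_filter]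
  refine sum_congr rfl fun k hk => ?_
  split_ifs with hkmn
  swap
  · simp [treeKernel, hkmn]
  have hkN : k ≤ G.N := by omega
  have hLE := ancestor_mem hδ hc hkN ℓ'
  rw [sum_eq_single_of_mem _ hLE fun L hL hne => ?_]
  · rw [setIntegral_congr_set (ancestor_ae_eq hδ hc hkN ℓ'),
      integral_biUnion_finset _ (fun ℓ _ => measurableSet_leaf ℓ) (leaf_pairwiseDisjoint _)
        fun ℓ _ => S.integrableOn_kernel_mul_leaf hδ hc hkmn.1 _ x (hf ℓ)]
    refine sum_congr rfl fun ℓ _ => ?_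
    have hm : μ.real ℓ ≠ 0 := (ENNReal.toReal_pos (measure_pos hδ hc hpos le_rfl ℓ.2).ne'
      (measure_ne_top _ _)).ne'
    rw [setIntegral_congr_fun (measurableSet_leaf ℓ) (g := fun y =>
        S.treeKernel hδ hc k ℓ' ℓ * f y) fun y hy => ?_, integral_const_mul, mul_smul_comm,
      smul_inv_smul₀ hm]
    simp only [treeKernel, if_pos hkmn, S.kernel_congr_leaf hδ hc hkmn.1 _ x ℓ hy]
    rw [S.kernel_congr_left hkmn.2 (ancestor_mem hδ hc hkmn.2 ℓ') _
      (leaf_subset_ancestor hδ hc hkmn.2 ℓ' hx)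
      (leaf_subset_ancestor hδ hc hkmn.2 ℓ' (point_mem hδ hc ℓ'))]
  · have hxL : x ∉ L := fun h => hne (DyadicLattice.eq_of_mem hkN hL hLE h
      (leaf_subset_ancestor hδ hc hkN ℓ' hx))
    simp [S.kernel_eq_zero hkmn.2 hxL]

lemma toFun_add (hpos : ∀ (x : X) (r : ℝ), 0 < r → 0 < μ (ball x r)) {f g fg : X → 𝕜}
    (hf : ∀ ℓ : G.Leaf, IntegrableOn f ℓ μ) (hg : ∀ ℓ : G.Leaf, IntegrableOn g ℓ μ)
    (h : fg =ᵐ[μ] fun y => f y + g y) (x : X) : S.toFun fg x = S.toFun f x + S.toFun g x := by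
  simp only [toFun, ← sum_add_distrib]
  refine sum_congr rfl fun k hk => sum_congr rfl fun L hL => ?_
  have hk' := (mem_filter.1 hk).2
  rw [← integral_add (S.integrableOn_kernel_mul hδ hc hpos hk'.1 hL x hf)
    (S.integrableOn_kernel_mul hδ hc hpos hk'.1 hL x hg)]
  refine integral_congr_ae (ae_restrict_of_ae ?_)
  filter_upwards [h] with y hy
  rw [hy, mul_add]

omit hδ hc in
lemma toFun_smul {f rf : X → 𝕜} (r : 𝕜) (h : rf =ᵐ[μ] fun y => r * f y) (x : X) :
    S.toFun rf x = r * S.toFun f x := by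
  simp only [toFun, mul_sum]
  refine sum_congr rfl fun k _ => sum_congr rfl fun L _ => ?_
  rw [← integral_const_mul]
  refine integral_congr_ae (ae_restrict_of_ae ?_)
  filter_upwards [h] with y hy
  rw [hy]; ring

end DyadicShift

/-! ### Weights and the boundedness of the shift -/

section Weight

variable {X : Type*} [MeasurableSpace X] {μ : Measure X} {w : X → ℝ}

lemma weighted_absolutelyContinuous : weighted μ w ≪ μ := withDensity_absolutelyContinuous _ _

lemma absolutelyContinuous_weighted (hw : Measurable w) (hpos : ∀ᵐ x ∂μ, 0 < w x) :
    μ ≪ weighted μ w :=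
  withDensity_absolutelyContinuous' hw.ennreal_ofReal.aemeasurable
    (hpos.mono fun x hx => by simpa using hx)

lemma lintegral_weighted (hw : Measurable w) {f : X → ℝ≥0∞} (hf : AEMeasurable f μ) (s : Set X)
    (hs : MeasurableSet s) :
    ∫⁻ x in s, f x ∂(weighted μ w) = ∫⁻ x in s, ENNReal.ofReal (w x) * f x ∂μ := by
  rw [weighted, restrict_withDensity hs,
    lintegral_withDensity_eq_lintegral_mul₀ hw.ennreal_ofReal.aemeasurable hf.restrict]
  rfl

/-- The Cauchy-Schwarz inequality with the weights `w` and `w⁻¹`. -/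
lemma sq_lintegral_le_weighted (hw : Measurable w) (hpos : ∀ᵐ x ∂μ, 0 < w x) {f : X → ℝ≥0∞}
    (hf : AEMeasurable f μ) {s : Set X} (hs : MeasurableSet s) :
    (∫⁻ x in s, f x ∂μ) ^ 2 ≤
      (∫⁻ x in s, f x ^ 2 ∂(weighted μ w)) * weighted μ (fun x => (w x)⁻¹) s := by
  -- Hölder's inequality for `f = (√w f) √(w⁻¹)`.
  set u : X → ℝ≥0∞ := fun x => ENNReal.ofReal (√(w x)) with hu
  set v : X → ℝ≥0∞ := fun x => ENNReal.ofReal (√(w x)⁻¹) with hv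
  have hum : Measurable u := (Real.continuous_sqrt.measurable.comp hw).ennreal_ofReal
  have hvm : Measurable v := (Real.continuous_sqrt.measurable.comp hw.inv).ennreal_ofReal
  have h1 : ∫⁻ x in s, f x ∂μ = ∫⁻ x in s, ((u * f) * v) x ∂μ := by
    refine lintegral_congr_ae (ae_restrict_of_ae ?_)
    filter_upwards [hpos] with x hx
    have : u x * v x = 1 := by
      simp only [hu, hv]
      rw [← ENNReal.ofReal_mul (Real.sqrt_nonneg _), ← Real.sqrt_mul hx.le, mul_inv_cancel₀ hx.ne']
      simp
    simp only [Pi.mul_apply]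
    rw [mul_right_comm, this, one_mul]
  have h2 := ENNReal.lintegral_mul_le_Lp_mul_Lq (μ.restrict s) Real.HolderConjugate.two_two
    (hum.aemeasurable.mul hf.restrict) hvm.aemeasurable
  rw [h1]
  refine (pow_le_pow_left₀ zero_le h2 2).trans_eq ?_
  rw [mul_pow, ← ENNReal.rpow_natCast, ← ENNReal.rpow_mul, ← ENNReal.rpow_natCast,
    ← ENNReal.rpow_mul]
  norm_num
  congr 1
  · rw [lintegral_weighted hw (hf.pow_const 2) s hs]
    refine lintegral_congr_ae (ae_restrict_of_ae ?_)
    filter_upwards [hpos] with x hx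
    simp only [hu, mul_pow]
    rw [← ENNReal.ofReal_pow (Real.sqrt_nonneg _), Real.sq_sqrt hx.le]
  · rw [weighted, withDensity_apply _ hs]
    refine lintegral_congr_ae (ae_restrict_of_ae ?_)
    filter_upwards [hpos] with x hx
    simp only [hv]
    rw [← ENNReal.ofReal_pow (Real.sqrt_nonneg _), Real.sq_sqrt (inv_nonneg.2 hx.le)]

end Weight

lemma eLpNorm_two_sq {X E : Type*} [MeasurableSpace X] [NormedAddCommGroup E] (ν : Measure X)
    (f : X → E) : eLpNorm f 2 ν ^ 2 = ∫⁻ x, ‖f x‖ₑ ^ 2 ∂ν := by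
  have := eLpNorm_nnreal_pow_eq_lintegral (μ := ν) (f := f) (p := 2) two_ne_zero
  simpa using this

namespace DyadicLattice

variable {X : Type*} [MetricSpace X] [MeasurableSpace X] {μ : Measure X} {δ c C₁ : ℝ} {M : ℕ}
  {G : DyadicLattice μ δ c C₁ M} {w : X → ℝ}

lemma weighted_div_mul_weighted_div_le {k : ℕ} (hk : k ≤ G.N) {Q : Set X} (hQ : Q ∈ G.E k) :
    weighted μ w Q / μ Q * (weighted μ (fun x => (w x)⁻¹) Q / μ Q) ≤ G.a2Char w := by
  have h : (⨍⁻ x in Q, ENNReal.ofReal (w x) ∂μ) * (⨍⁻ x in Q, ENNReal.ofReal (w x)⁻¹ ∂μ) ≤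
      G.a2Char w :=
    le_iSup₂_of_le k (show k ∈ Set.Iic G.N from hk) (le_iSup₂_of_le Q hQ le_rfl)
  rw [setLAverage_eq, setLAverage_eq] at h
  rwa [weighted, weighted, withDensity_apply _ (G.measurable k hk Q hQ),
    withDensity_apply _ (G.measurable k hk Q hQ)]

variable (hδ : 0 < δ) (hc : 0 < c) (hball : ∀ (x : X) (r : ℝ), 0 < r → 0 < μ (ball x r))
include hδ hc hball

lemma weighted_pos (hw : Measurable w) (hpos : ∀ᵐ x ∂μ, 0 < w x) {k : ℕ} (hk : k ≤ G.N) {Q : Set X}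
    (hQ : Q ∈ G.E k) : 0 < weighted μ w Q :=
  pos_iff_ne_zero.2 fun h =>
    (measure_pos hδ hc hball hk hQ).ne' (absolutelyContinuous_weighted hw hpos h)

variable [IsFiniteMeasure μ]

/-- Finiteness of the characteristic makes `w` and its inverse integrable on the cubes. -/
lemma weighted_ne_top (hw : Measurable w) (hpos : ∀ᵐ x ∂μ, 0 < w x) (hA : G.a2Char w < ∞) {k : ℕ}
    (hk : k ≤ G.N) {Q : Set X} (hQ : Q ∈ G.E k) :
    weighted μ w Q ≠ ∞ ∧ weighted μ (fun x => (w x)⁻¹) Q ≠ ∞ := by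
  have h := (weighted_div_mul_weighted_div_le hk hQ).trans_lt hA
  have hpos' : ∀ᵐ x ∂μ, 0 < (w x)⁻¹ := hpos.mono fun x hx => inv_pos.2 hx
  have h1 : weighted μ w Q / μ Q ≠ 0 :=
    ENNReal.div_ne_zero.2 ⟨(weighted_pos hδ hc hball hw hpos hk hQ).ne', measure_ne_top _ _⟩
  have h2 : weighted μ (fun x => (w x)⁻¹) Q / μ Q ≠ 0 :=
    ENNReal.div_ne_zero.2 ⟨(weighted_pos hδ hc hball hw.inv hpos' hk hQ).ne', measure_ne_top _ _⟩
  constructor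
  · intro htop
    rw [htop, ENNReal.top_div_of_ne_top (measure_ne_top _ _), ENNReal.top_mul h2] at h
    exact lt_irrefl _ h
  · intro htop
    rw [htop, ENNReal.top_div_of_ne_top (measure_ne_top _ _), ENNReal.mul_top h1] at h
    exact lt_irrefl _ h

lemma mass_mul_mass_le (hw : Measurable w) (hpos : ∀ᵐ x ∂μ, 0 < w x) (hA : G.a2Char w < ∞) {k : ℕ}
    (hk : k ≤ G.N) (ℓ : G.Leaf) :
    (G.tree hδ hc).mass (fun ℓ' => (weighted μ w).real ℓ') k ℓ *
      (G.tree hδ hc).mass (fun ℓ' => (weighted μ fun x => (w x)⁻¹).real ℓ') k ℓ ≤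
      (G.a2Char w).toReal * (G.tree hδ hc).mass (fun ℓ' => μ.real ℓ') k ℓ ^ 2 := by
  have hQ := ancestor_mem hδ hc hk ℓ
  rw [← measureReal_ancestor hδ hc .rfl (fun _ => measure_ne_top _ _) hk,
    ← measureReal_ancestor hδ hc weighted_absolutelyContinuous
      (fun ℓ' => (weighted_ne_top hδ hc hball hw hpos hA le_rfl ℓ'.2).1) hk,
    ← measureReal_ancestor hδ hc weighted_absolutelyContinuous
      (fun ℓ' => (weighted_ne_top hδ hc hball hw hpos hA le_rfl ℓ'.2).2) hk]
  have h := ENNReal.toReal_mono hA.ne (weighted_div_mul_weighted_div_le hk hQ (w := w))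
  have hm : 0 < (μ (G.ancestor k ℓ)).toReal :=
    ENNReal.toReal_pos (measure_pos hδ hc hball hk hQ).ne' (measure_ne_top _ _)
  rw [ENNReal.toReal_mul, ENNReal.toReal_div, ENNReal.toReal_div, div_mul_div_comm,
    div_le_iff₀ (by positivity)] at h
  rw [sq]
  exact h

lemma integrableOn_leaf (hw : Measurable w) (hpos : ∀ᵐ x ∂μ, 0 < w x) (hA : G.a2Char w < ∞)
    {𝕜 : Type*} [RCLike 𝕜] (f : Lp 𝕜 2 (weighted μ w)) (ℓ : G.Leaf) : IntegrableOn f ℓ μ := by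
  refine ⟨(Lp.stronglyMeasurable f).aestronglyMeasurable, ?_⟩
  have h := sq_lintegral_le_weighted hw hpos (Lp.stronglyMeasurable f).enorm.aemeasurable
    (measurableSet_leaf ℓ)
  have h1 : ∫⁻ x in ℓ, ‖f x‖ₑ ^ 2 ∂(weighted μ w) ≠ ∞ := by
    refine ((setLIntegral_le_lintegral _ _).trans_lt ?_).ne
    rw [← eLpNorm_two_sq]
    exact ENNReal.pow_lt_top (Lp.eLpNorm_lt_top f)
  have h2 : (∫⁻ x in ℓ, ‖f x‖ₑ ∂μ) ^ 2 < ∞ := h.trans_lt (ENNReal.mul_lt_top h1.lt_top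
    (weighted_ne_top hδ hc hball hw hpos hA le_rfl ℓ.2).2.lt_top)
  exact (ENNReal.pow_lt_top_iff.1 h2).resolve_right two_ne_zero

end DyadicLattice

namespace DyadicShift

open DyadicLattice

variable {X : Type*} [MetricSpace X] [MeasurableSpace X] {μ : Measure X} [IsFiniteMeasure μ]
  {δ c C₁ : ℝ} {M : ℕ} {G : DyadicLattice μ δ c C₁ M} {K : ℝ} {H : HaarSystem G K} {𝕜 : Type*}
  [RCLike 𝕜] {m n : ℕ} (S : DyadicShift 𝕜 H m n) (hδ : 0 < δ) (hc : 0 < c)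
  (hball : ∀ (x : X) (r : ℝ), 0 < r → 0 < μ (ball x r)) {w : X → ℝ}
include hδ hc hball

lemma aestronglyMeasurable_toFun {f : X → 𝕜} (hf : ∀ ℓ : G.Leaf, IntegrableOn f ℓ μ) :
    AEStronglyMeasurable (S.toFun f) μ := by
  refine ⟨fun x => ∑ ℓ : G.Leaf, (ℓ : Set X).indicator (fun _ => S.toFun f (point hδ hc ℓ)) x,
    Finset.stronglyMeasurable_fun_sum _ fun ℓ _ =>
      stronglyMeasurable_const.indicator (measurableSet_leaf ℓ), ?_⟩
  filter_upwards [G.cover G.N le_rfl] with x ⟨R, hR, hx⟩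
  rw [sum_eq_single_of_mem (⟨R, hR⟩ : G.Leaf) (mem_univ _) fun ℓ _ hne => ?_]
  · rw [Set.indicator_of_mem hx, S.toFun_eq_shiftOp hδ hc hball hf (ℓ' := ⟨R, hR⟩) hx,
      S.toFun_eq_shiftOp hδ hc hball hf (point_mem hδ hc ⟨R, hR⟩)]
  · refine Set.indicator_of_notMem (fun h => hne (Subtype.ext ?_)) _
    exact DyadicLattice.eq_of_mem le_rfl ℓ.2 hR h hx

/-- The weighted norm inequality in terms of integrals. -/
lemma lintegral_toFun_sq_le [CompactSpace X] {D : ℝ≥0} (hD : IsDoublingWith μ D) {q : ℕ}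
    (hq : C₁ < 2 ^ q * (c * δ)) (hw : Measurable w) (hpos : ∀ᵐ x ∂μ, 0 < w x)
    (hA : G.a2Char w < ∞) {f : X → 𝕜} (hfm : AEMeasurable (fun x => ‖f x‖ₑ) μ)
    (hint : ∀ ℓ : G.Leaf, IntegrableOn f ℓ μ) :
    ∫⁻ x, ‖S.toFun f x‖ₑ ^ 2 ∂(weighted μ w) ≤ ENNReal.ofReal
      (128 * ((M : ℝ) ^ 2 * K ^ 2) * max 1 ((D : ℝ) ^ q) ^ 2 * (m + n + 1) *
        (G.a2Char w).toReal) ^ 2 * ∫⁻ x, ‖f x‖ₑ ^ 2 ∂(weighted μ w) := by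
  set ν := weighted μ w with hν
  set τ := weighted μ fun x => (w x)⁻¹ with hτ
  have hpos' : ∀ᵐ x ∂μ, 0 < (w x)⁻¹ := hpos.mono fun x hx => inv_pos.2 hx
  have hνμ : ν ≪ μ := weighted_absolutelyContinuous
  have hνtop : ∀ ℓ : G.Leaf, ν ℓ ≠ ∞ := fun ℓ =>
    (weighted_ne_top hδ hc hball hw hpos hA le_rfl ℓ.2).1
  have hτtop : ∀ ℓ : G.Leaf, τ ℓ ≠ ∞ := fun ℓ =>
    (weighted_ne_top hδ hc hball hw hpos hA le_rfl ℓ.2).2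
  have hμpos : ∀ ℓ : G.Leaf, 0 < μ.real ℓ := fun ℓ =>
    ENNReal.toReal_pos (measure_pos hδ hc hball le_rfl ℓ.2).ne' (measure_ne_top _ _)
  have hνpos : ∀ ℓ : G.Leaf, 0 < ν.real ℓ := fun ℓ =>
    ENNReal.toReal_pos (weighted_pos hδ hc hball hw hpos le_rfl ℓ.2).ne' (hνtop ℓ)
  have hτpos : ∀ ℓ : G.Leaf, 0 < τ.real ℓ := fun ℓ =>
    ENNReal.toReal_pos (weighted_pos hδ hc hball hw.inv hpos' le_rfl ℓ.2).ne' (hτtop ℓ)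
  have hντ : ∀ ℓ : G.Leaf, μ.real ℓ ^ 2 ≤ τ.real ℓ * ν.real ℓ := fun ℓ => by
    have h := sq_lintegral_le_weighted hw hpos (f := fun _ => 1) aemeasurable_const
      (measurableSet_leaf ℓ)
    simp only [one_pow, lintegral_const, one_mul, Measure.restrict_apply_univ] at h
    have h' := ENNReal.toReal_mono (ENNReal.mul_ne_top (hνtop ℓ) (hτtop ℓ)) h
    rw [ENNReal.toReal_pow, ENNReal.toReal_mul, mul_comm] at h'
    exact h'
  have hsplit : ∀ u : X → ℝ≥0∞, ∫⁻ x, u x ∂ν = ∑ ℓ : G.Leaf, ∫⁻ x in ℓ, u x ∂ν := fun u => by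
    rw [← setLIntegral_univ, setLIntegral_congr (hνμ.ae_eq G.univ_ae_eq),
      lintegral_biUnion_finset (leaf_pairwiseDisjoint _) fun ℓ _ => measurableSet_leaf ℓ]
  -- On the tree `f` is represented by its averages over the leaves.
  set F : G.Leaf → 𝕜 := fun ℓ => (μ.real ℓ)⁻¹ • ∫ y in (ℓ : Set X), f y ∂μ with hF
  set T := (G.tree hδ hc).shiftOp (fun ℓ => μ.real ℓ) (S.treeKernel hδ hc) G.N F with hT
  set C := 128 * ((M : ℝ) ^ 2 * K ^ 2) * max 1 ((D : ℝ) ^ q) ^ 2 * (m + n + 1) *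
    (G.a2Char w).toReal with hC
  have hmain := (S.isShiftKernel_treeKernel hδ hc hball).sum_norm_shiftOp_sq_le hμpos
    (le_max_left 1 ((D : ℝ) ^ q)) (mass_le_mul_mass_succ hδ hc hD hq) (by positivity) hνpos hτpos
    hντ ENNReal.toReal_nonneg (fun k hk ℓ => mass_mul_mass_le hδ hc hball hw hpos hA hk ℓ) F
  have hleft : ∫⁻ x, ‖S.toFun f x‖ₑ ^ 2 ∂ν =
      ENNReal.ofReal (∑ ℓ : G.Leaf, ν.real ℓ * ‖T ℓ‖ ^ 2) := by
    rw [hsplit, ENNReal.ofReal_sum_of_nonneg fun ℓ _ => by have := hνpos ℓ; positivity]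
    refine sum_congr rfl fun ℓ _ => ?_
    rw [setLIntegral_congr_fun (g := fun _ => ‖T ℓ‖ₑ ^ 2) (measurableSet_leaf ℓ) fun x hx => by
      simp only [S.toFun_eq_shiftOp hδ hc hball hint hx, hT, hF]]
    rw [setLIntegral_const, ENNReal.ofReal_mul (hνpos ℓ).le, ENNReal.ofReal_pow (norm_nonneg _),
      ofReal_norm, measureReal_def, ENNReal.ofReal_toReal (hνtop ℓ), mul_comm]
  have hright : ENNReal.ofReal (∑ ℓ : G.Leaf, τ.real ℓ * (‖F ℓ‖ * μ.real ℓ / τ.real ℓ) ^ 2) ≤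
      ∫⁻ x, ‖f x‖ₑ ^ 2 ∂ν := by
    rw [hsplit, ENNReal.ofReal_sum_of_nonneg fun ℓ _ => by have := hτpos ℓ; positivity]
    refine sum_le_sum fun ℓ _ => ?_
    have e : τ.real ℓ * (‖F ℓ‖ * μ.real ℓ / τ.real ℓ) ^ 2 =
        ‖∫ y in (ℓ : Set X), f y ∂μ‖ ^ 2 / τ.real ℓ := by
      have h1 := (hμpos ℓ).ne'
      have h2 := (hτpos ℓ).ne'
      simp only [hF]
      rw [norm_smul, norm_inv, Real.norm_of_nonneg (hμpos ℓ).le]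
      field_simp
    -- Cauchy-Schwarz on the leaf: `‖∫ f dμ‖ ^ 2 ≤ (∫ ‖f‖ ^ 2 w dμ) (∫ w⁻¹ dμ)`.
    rw [e, ENNReal.ofReal_div_of_pos (hτpos ℓ), measureReal_def, ENNReal.ofReal_toReal (hτtop ℓ),
      ENNReal.ofReal_pow (norm_nonneg _), ofReal_norm]
    refine ENNReal.div_le_of_le_mul ?_
    exact (pow_le_pow_left₀ zero_le (enorm_integral_le_lintegral_enorm _) 2).trans
      (sq_lintegral_le_weighted hw hpos hfm (measurableSet_leaf ℓ))
  rw [hleft, ← ENNReal.ofReal_pow (by positivity)]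
  refine (ENNReal.ofReal_le_ofReal hmain).trans ?_
  rw [ENNReal.ofReal_mul (by positivity)]
  gcongr

end DyadicShift

theorem theorem2p1 (D : ℝ≥0) (A : ℕ) (δ c C₁ K : ℝ) (M : ℕ)
    (hδ₀ : 0 < δ) (hδ₁ : δ < 1) (hc : 0 < c) :
    ∃ C : ℝ, 0 < C ∧
      ∀ (X : Type*) [MetricSpace X] [CompactSpace X] [MeasurableSpace X] [BorelSpace X]
        (μ : Measure X) [IsFiniteMeasure μ],
        GeometricallyDoubling X A → IsDoublingWith μ D →
      ∀ (G : DyadicLattice μ δ c C₁ M) (H : HaarSystem G K)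
        (𝕜 : Type*) [RCLike 𝕜] (m n : ℕ) (S : DyadicShift 𝕜 H m n)
        (w : X → ℝ), Measurable w → (∀ᵐ x ∂μ, 0 < w x) → G.a2Char w < ∞ →
      ∃ T : Lp 𝕜 2 (weighted μ w) →L[𝕜] Lp 𝕜 2 (weighted μ w),
        (∀ f : Lp 𝕜 2 (weighted μ w),
          (∀ k, k + m < G.N → k + n < G.N → ∀ L ∈ G.E k, ∀ x,
            IntegrableOn (fun y => S.kernel k L x y * f y) L μ) ∧
          T f =ᵐ[weighted μ w] S.toFun f) ∧
        ‖T‖ ≤ C * ((m : ℝ) + n + 1) ^ 3 * (G.a2Char w).toReal := by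
  obtain ⟨q, hq⟩ : ∃ q : ℕ, C₁ < 2 ^ q * (c * δ) := by
    obtain ⟨q, hq⟩ := pow_unbounded_of_one_lt (C₁ / (c * δ)) one_lt_two
    exact ⟨q, (div_lt_iff₀ (by positivity)).1 hq⟩
  set C := 128 * ((M : ℝ) ^ 2 * K ^ 2) * max 1 ((D : ℝ) ^ q) ^ 2 with hC
  have hC0 : 0 ≤ C := by positivity
  refine ⟨C + 1, by positivity, ?_⟩
  intro X _ _ _ _ μ _ _ hD G H 𝕜 _ m n S w hw hpos hA
  have hball : ∀ (x : X) (r : ℝ), 0 < r → 0 < μ (ball x r) := fun x r hr => (hD x r hr).1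
  have hint := DyadicLattice.integrableOn_leaf (𝕜 := 𝕜) hδ₀ hc hball hw hpos hA
  set C' := C * (m + n + 1) * (G.a2Char w).toReal with hC'
  have hC'0 : 0 ≤ C' := by positivity
  have hμν : μ ≪ weighted μ w := absolutelyContinuous_weighted hw hpos
  have hnorm : ∀ f : Lp 𝕜 2 (weighted μ w), eLpNorm (S.toFun f) 2 (weighted μ w) ≤
      ENNReal.ofReal C' * eLpNorm f 2 (weighted μ w) := by
    intro f
    refine (ENNReal.pow_le_pow_left_iff two_ne_zero).1 ?_
    rw [mul_pow, eLpNorm_two_sq, eLpNorm_two_sq]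
    exact S.lintegral_toFun_sq_le hδ₀ hc hball hD hq hw hpos hA
      (Lp.stronglyMeasurable f).enorm.aemeasurable (hint f)
  have hmem : ∀ f : Lp 𝕜 2 (weighted μ w), MemLp (S.toFun f) 2 (weighted μ w) := fun f =>
    ⟨(S.aestronglyMeasurable_toFun hδ₀ hc hball (hint f)).mono_ac weighted_absolutelyContinuous,
      (hnorm f).trans_lt (ENNReal.mul_lt_top ENNReal.ofReal_lt_top (Lp.eLpNorm_lt_top f))⟩
  let T₀ : Lp 𝕜 2 (weighted μ w) →ₗ[𝕜] Lp 𝕜 2 (weighted μ w) :=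
    { toFun := fun f => (hmem f).toLp
      map_add' := fun f g => by
        rw [← MemLp.toLp_add]
        refine MemLp.toLp_congr _ _ (Filter.Eventually.of_forall fun x => ?_)
        exact S.toFun_add hδ₀ hc hball (hint f) (hint g) (hμν.ae_eq (Lp.coeFn_add f g)) x
      map_smul' := fun r f => by
        rw [RingHom.id_apply, ← MemLp.toLp_const_smul]
        refine MemLp.toLp_congr _ _ (Filter.Eventually.of_forall fun x => ?_)
        exact S.toFun_smul r (hμν.ae_eq (Lp.coeFn_smul r f)) x }
  have hT₀ : ∀ f, ‖T₀ f‖ ≤ C' * ‖f‖ := fun f => by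
    change ‖(hmem f).toLp‖ ≤ _
    rw [Lp.norm_toLp, Lp.norm_def, ← ENNReal.toReal_ofReal hC'0, ← ENNReal.toReal_mul]
    exact ENNReal.toReal_mono (ENNReal.mul_ne_top ENNReal.ofReal_ne_top (Lp.eLpNorm_ne_top f))
      (hnorm f)
  refine ⟨T₀.mkContinuous C' hT₀, fun f => ⟨fun k hkm _ L hL x =>
    S.integrableOn_kernel_mul hδ₀ hc hball hkm hL x (hint f), (hmem f).coeFn_toLp⟩, ?_⟩
  refine (T₀.mkContinuous_norm_le hC'0 hT₀).trans ?_
  have h1 : (1 : ℝ) ≤ m + n + 1 := by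
    have : (0 : ℝ) ≤ m + n := by positivity
    linarith
  exact mul_le_mul_of_nonneg_right (mul_le_mul (by linarith) (le_self_pow₀ h1 (by norm_num))
    (by positivity) (by positivity)) ENNReal.toReal_nonneg
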